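/- **Setting.** Let $H_1,H_2$ be complex Hilbert spaces, and let $A_1:\mathcal D(A_1)\subset H_1\to H_1$ and $A:\mathcal D(A)\subset H_2\to H_2$ be strictly positive self-adjoint operators (i.e. $\langle A_1x,x\rangle\ge m\|x\|^2$ on $\mathcal D(A_1)$ for some $m>0$, and likewise for $A$). Put $H_{1,1}=\mathcal D(A_1)$, $H_{1,1/2}=\mathcal D(A_1^{1/2})$ with inner product $\langle A_1^{1/2}u,A_1^{1/2}v\rangle_{H_1}$, and let $H_{1,-1/2}$ be the (anti)dual of $H_{1,1/2}$ with respect to the pivot space $H_1$; define $H_{2,1}$, $H_{2,1/2}$, $H_{2,-1/2}$ in the same way from $A$. Let $A_2\in\mathcal L(H_1,H_{2,-1/2})$ restrict to an operator in $\mathcal L(H_{1,1/2},H_2)$, let $A_2^*\in\mathcal L(H_{2,1/2},H_1)$ be its adjoint, and assume that $A_2^*$ maps $H_{2,1}$ into $H_{1,1/2}$ and that $A=A_2A_2^*$ on $H_{2,1}$. Let $C\in\mathcal L(H_2,H_{1,-1/2})$ restrict to an operator in $\mathcal L(H_{2,1/2},H_1)$, and let $C^*\in\mathcal L(H_{1,1/2},H_2)$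 be its adjoint. Let $\tau>0$, let $H_1^\tau$ be $H_1$ with the inner product $\tau\langle u,v\rangle_{H_1}$, and let $$\mathcal H=H_{1,1/2}\times H_1\times H_2\times H_1^\tau,\qquad \mathcal H_0=H_{1,1/2}\times H_1\times H_2$$ with the sums of the inner products of the factors. Define $$\mathcal A_d\,(u_1,u_2,v,w)=\Big(u_2,\;-A_1u_1-Cv,\;C^*u_2-A_2w,\;\tfrac1\tau A_2^*v-\tfrac1\tau w\Big),\qquad \mathcal D(\mathcal A_d)=H_{1,1}\times H_{1,1/2}\times H_{2,1/2}\times H_{1,1/2}\subset\mathcal H,$$ $$\mathcal A\,(u_1,u_2,v)=\big(u_2,\;-A_1u_1-Cv,\;C^*u_2-Av\big),\qquad \mathcal D(\mathcal A)=H_{1,1}\times H_{1,1/2}\times H_{2,1}\subset\mathcal H_0.$$ **Theorem 2.1.** 1. $\mathcal A_d$, with the domain above, generates a strongly continuous contraction semigroup on $\mathcal H$ if and only if the natural domain $\{w\in H_1: A_2w\in H_2\}$ of $A_2$, as an unbounded operator from $H_1$ to $H_2$, is $H_{1,1/2}$. 2. Without any condition on the natural domain of $A_2$, the operator $\mathcal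 A_d$ is closable and its closure generates a strongly continuous contraction semigroup on $\mathcal H$. 3. $\mathcal A$ generates a strongly continuous contraction semigroup on $\mathcal H_0$. -/

import Mathlib

open Filter Topology
open scoped NNReal

noncomputable section

/-! ## Contraction semigroups and their generators -/

/-- A strongly continuous semigroup of contractions on the space `X`. -/
structure ContractionSemigroup (X : Type*) [NormedAddCommGroup X] [NormedSpace ℂ X] where
  T : ℝ≥0 → X →L[ℂ] X
  map_zero : T 0 = ContinuousLinearMap.id ℂ X
  map_add : ∀ s t, T (s + t) = (T s).comp (T t)
  strongly_continuous : ∀ x, Continuous fun t => T t x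
  contraction : ∀ t, ‖T t‖ ≤ 1

/-- `B` is the infinitesimal generator of `S`: `x` lies in the domain of `B` and `B x = y` exactly
when the difference quotients `(T h x - x) / h` converge to `y` as `h ↓ 0`. -/
def ContractionSemigroup.IsGenerator {X : Type*} [NormedAddCommGroup X] [NormedSpace ℂ X]
    (S : ContractionSemigroup X) (B : X →ₗ.[ℂ] X) : Prop :=
  ∀ x y : X, (x, y) ∈ B.graph ↔
    Tendsto (fun h : ℝ≥0 => ((h : ℝ)⁻¹ : ℂ) • (S.T h x - x)) (𝓝[>] 0) (𝓝 y)

/-- The (unbounded) operator `B` generates a strongly continuous contraction semigroup. -/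
def GeneratesContractionSemigroup {X : Type*} [NormedAddCommGroup X] [NormedSpace ℂ X]
    (B : X →ₗ.[ℂ] X) : Prop :=
  ∃ S : ContractionSemigroup X, S.IsGenerator B

/-! ## Positive self-adjoint operators and their square roots -/

/-- A (strictly) positive self-adjoint operator on the Hilbert space `H`. -/
structure PosSelfAdjoint (H : Type*) [NormedAddCommGroup H] [InnerProductSpace ℂ H]
    [CompleteSpace H] where
  op : H →ₗ.[ℂ] H
  selfAdjoint : IsSelfAdjoint op
  pos : ∃ m : ℝ, 0 < m ∧ ∀ x : op.domain, m * ‖(x : H)‖ ^ 2 ≤ (inner ℂ (op x) (x : H)).re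

namespace PosSelfAdjoint

variable {H : Type*} [NormedAddCommGroup H] [InnerProductSpace ℂ H] [CompleteSpace H]

theorem norm_le (P : PosSelfAdjoint H) :
    ∃ m : ℝ, 0 < m ∧ ∀ x : P.op.domain, m * ‖(x : H)‖ ≤ ‖P.op x‖ := by
  obtain ⟨m, hm, h⟩ := P.pos
  refine ⟨m, hm, fun x => ?_⟩
  have h1 : (inner ℂ (P.op x) (x : H)).re ≤ ‖P.op x‖ * ‖(x : H)‖ :=
    (Complex.re_le_norm _).trans (norm_inner_le_norm _ _)
  rcases eq_or_lt_of_le (norm_nonneg (x : H)) with h0 | h0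
  · rw [← h0]; simp
  · nlinarith [h x]

theorem op_injective (P : PosSelfAdjoint H) : Function.Injective P.op.toFun := by
  obtain ⟨m, hm, h⟩ := P.norm_le
  rw [injective_iff_map_eq_zero]
  intro x hx
  have h1 := h x
  have h2 : P.op x = 0 := hx
  rw [h2, norm_zero] at h1
  have h3 : ‖(x : H)‖ ≤ 0 := by
    by_contra hc
    push Not at hc
    nlinarith
  exact Subtype.ext (norm_le_zero_iff.mp h3)

theorem op_surjective (P : PosSelfAdjoint H) : Function.Surjective P.op.toFun := by
  obtain ⟨m, hm, h⟩ := P.norm_le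
  have hdense := P.selfAdjoint.dense_domain
  have hclosed : IsClosed (LinearMap.range P.op.toFun : Set H) := by
    apply IsSeqClosed.isClosed
    intro y y₀ hy hlim
    choose x hx using hy
    have hx' : ∀ n, P.op (x n) = y n := hx
    have hcau : CauchySeq fun n => (x n : H) := by
      rw [Metric.cauchySeq_iff]
      intro ε hε
      obtain ⟨N, hN⟩ := Metric.cauchySeq_iff.mp hlim.cauchySeq (m * ε) (by positivity)
      refine ⟨N, fun i hi j hj => ?_⟩
      have h1 := hN i hi j hj
      have h2 := h (x i - x j)
      rw [LinearPMap.map_sub, hx', hx', AddSubgroupClass.coe_sub] at h2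
      rw [dist_eq_norm] at h1 ⊢
      exact lt_of_mul_lt_mul_left (h2.trans_lt h1) hm.le
    obtain ⟨x₀, hx₀⟩ := cauchySeq_tendsto_of_complete hcau
    have hg : (x₀, y₀) ∈ P.op.graph := by
      refine P.selfAdjoint.isClosed.mem_of_tendsto (hx₀.prodMk_nhds hlim)
        (Eventually.of_forall fun n => ?_)
      rw [← hx' n]
      exact P.op.mem_graph (x n)
    obtain ⟨z, -, hz⟩ := (LinearPMap.mem_graph_iff _).mp hg
    exact ⟨z, hz⟩
  have horth : (LinearMap.range P.op.toFun)ᗮ = ⊥ := by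
    rw [Submodule.eq_bot_iff]
    intro y hy
    have hy' : ∀ x : P.op.domain, inner ℂ (0 : H) (x : H) = inner ℂ y (P.op x) := fun x => by
      rw [inner_zero_left]
      exact (Submodule.mem_orthogonal' _ _ |>.mp hy _ ⟨x, rfl⟩).symm
    have hmem : y ∈ P.op.adjoint.domain := LinearPMap.mem_adjoint_domain_of_exists y ⟨0, hy'⟩
    have hg : (y, (0 : H)) ∈ P.op.adjoint.graph := by
      rw [← LinearPMap.adjoint_apply_eq hdense ⟨y, hmem⟩ hy']
      exact P.op.adjoint.mem_graph ⟨y, hmem⟩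
    rw [LinearPMap.isSelfAdjoint_def.mp P.selfAdjoint] at hg
    obtain ⟨z, hz1, hz2⟩ := (LinearPMap.mem_graph_iff _).mp hg
    have : z = 0 := P.op_injective (hz2.trans (map_zero P.op.toFun).symm)
    have hz : (z : H) = y := hz1
    rw [← hz, this]; rfl
  have : LinearMap.range P.op.toFun = ⊤ := by
    rw [← hclosed.submodule_topologicalClosure_eq]
    exact Submodule.topologicalClosure_eq_top_iff.mpr horth
  exact LinearMap.range_eq_top.mp this

/-- The bounded inverse `A⁻¹ : H → H`. -/
def inv (P : PosSelfAdjoint H) : H →L[ℂ] H :=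
  let e := (LinearEquiv.ofBijective P.op.toFun ⟨P.op_injective, P.op_surjective⟩).symm
  LinearMap.mkContinuousOfExistsBound (P.op.domain.subtype ∘ₗ e.toLinearMap) (by
    obtain ⟨m, hm, h⟩ := P.norm_le
    refine ⟨m⁻¹, fun y => ?_⟩
    have h1 := h (e y)
    have h2 : P.op (e y) = y :=
      (LinearEquiv.ofBijective P.op.toFun ⟨P.op_injective, P.op_surjective⟩).apply_symm_apply y
    rw [h2] at h1
    rw [inv_mul_eq_div, le_div_iff₀' hm]
    exact h1)

theorem inv_op (P : PosSelfAdjoint H) (x : P.op.domain) : P.inv (P.op x) = x :=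
  congrArg Subtype.val
    ((LinearEquiv.ofBijective P.op.toFun ⟨P.op_injective, P.op_surjective⟩).symm_apply_apply x)

theorem inv_mem (P : PosSelfAdjoint H) (y : H) : P.inv y ∈ P.op.domain :=
  ((LinearEquiv.ofBijective P.op.toFun ⟨P.op_injective, P.op_surjective⟩).symm y).2

theorem op_inv (P : PosSelfAdjoint H) (y : H) : P.op ⟨P.inv y, P.inv_mem y⟩ = y :=
  (LinearEquiv.ofBijective P.op.toFun ⟨P.op_injective, P.op_surjective⟩).apply_symm_apply y

theorem inv_injective (P : PosSelfAdjoint H) : Function.Injective P.inv := fun y z h => by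
  have hs : (⟨P.inv y, P.inv_mem y⟩ : P.op.domain) = ⟨P.inv z, P.inv_mem z⟩ := Subtype.ext h
  rw [← P.op_inv y, ← P.op_inv z, hs]

theorem inv_nonneg (P : PosSelfAdjoint H) : 0 ≤ P.inv := by
  rw [ContinuousLinearMap.nonneg_iff_isPositive, ContinuousLinearMap.isPositive_iff_complex]
  intro y
  obtain ⟨m, hm, h⟩ := P.pos
  have hF : P.op.adjoint.IsFormalAdjoint P.op :=
    LinearPMap.adjoint_isFormalAdjoint P.selfAdjoint.dense_domain
  rw [LinearPMap.isSelfAdjoint_def.mp P.selfAdjoint] at hF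
  have h1 := hF ⟨P.inv y, P.inv_mem y⟩ ⟨P.inv y, P.inv_mem y⟩
  have h2 := h ⟨P.inv y, P.inv_mem y⟩
  rw [P.op_inv] at h1 h2
  have h3 : 0 ≤ (inner ℂ y (P.inv y)).re := le_trans (by positivity) h2
  refine ⟨?_, ?_⟩
  · rw [← h1]
    refine Complex.conj_eq_iff_re.mp ?_
    rw [inner_conj_symm]
    exact h1.symm
  · rw [← h1]; exact h3

/-- `A^(-1/2)`, the nonnegative square root of the bounded nonnegative operator `A⁻¹`. -/
def invSqrt (P : PosSelfAdjoint H) : H →L[ℂ] H := CFC.sqrt P.inv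

theorem invSqrt_invSqrt (P : PosSelfAdjoint H) (x : H) : P.invSqrt (P.invSqrt x) = P.inv x :=
  congrArg (fun T : H →L[ℂ] H => T x) (CFC.sqrt_mul_sqrt_self P.inv P.inv_nonneg)

theorem invSqrt_injective (P : PosSelfAdjoint H) : Function.Injective P.invSqrt := fun x y h =>
  P.inv_injective (by rw [← P.invSqrt_invSqrt, ← P.invSqrt_invSqrt, h])

/-- The unbounded operator `A^(1/2)`: the inverse of `A^(-1/2)`, with domain the range of
`A^(-1/2)`. -/
def sqrt (P : PosSelfAdjoint H) : H →ₗ.[ℂ] H :=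
  { domain := LinearMap.range P.invSqrt.toLinearMap
    toFun := (LinearEquiv.ofInjective P.invSqrt.toLinearMap P.invSqrt_injective).symm.toLinearMap }

theorem invSqrt_mem (P : PosSelfAdjoint H) (y : H) : P.invSqrt y ∈ P.sqrt.domain := ⟨y, rfl⟩

theorem invSqrt_sqrt (P : PosSelfAdjoint H) (x : P.sqrt.domain) : P.invSqrt (P.sqrt x) = x :=
  congrArg Subtype.val
    ((LinearEquiv.ofInjective P.invSqrt.toLinearMap P.invSqrt_injective).apply_symm_apply x)

theorem sqrt_invSqrt (P : PosSelfAdjoint H) (y : H) :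
    P.sqrt ⟨P.invSqrt y, P.invSqrt_mem y⟩ = y :=
  P.invSqrt_injective (P.invSqrt_sqrt _)

/-- `A^(1/2) ∘ A^(1/2) = A`, as unbounded operators. -/
theorem mem_op_graph_iff (P : PosSelfAdjoint H) (x y : H) :
    (x, y) ∈ P.op.graph ↔ ∃ z, (x, z) ∈ P.sqrt.graph ∧ (z, y) ∈ P.sqrt.graph := by
  have hs : ∀ a b : H, (a, b) ∈ P.sqrt.graph ↔ a = P.invSqrt b := fun a b => by
    constructor
    · intro h
      obtain ⟨c, hc1, hc2⟩ := (LinearPMap.mem_graph_iff _).mp h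
      simp only at hc1 hc2
      rw [← hc1, ← hc2, P.invSqrt_sqrt]
    · rintro rfl
      exact (LinearPMap.mem_graph_iff _).mpr ⟨⟨_, P.invSqrt_mem b⟩, rfl, P.sqrt_invSqrt b⟩
  have ha : (x, y) ∈ P.op.graph ↔ x = P.inv y := by
    constructor
    · intro h
      obtain ⟨c, hc1, hc2⟩ := (LinearPMap.mem_graph_iff _).mp h
      simp only at hc1 hc2
      rw [← hc1, ← hc2, P.inv_op]
    · rintro rfl
      exact (LinearPMap.mem_graph_iff _).mpr ⟨⟨_, P.inv_mem y⟩, rfl, P.op_inv y⟩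
  simp only [hs, ha, ← P.invSqrt_invSqrt]
  exact ⟨fun h => ⟨P.invSqrt y, h, rfl⟩, fun ⟨z, h1, h2⟩ => by rw [h1, h2]⟩

/-- The space `H_{1/2} = D(A^(1/2))`, carrying the inner product
`⟪u, v⟫_{1/2} = ⟪A^(1/2) u, A^(1/2) v⟫`. -/
def Half (P : PosSelfAdjoint H) : Type _ := P.sqrt.domain

namespace Half

variable (P : PosSelfAdjoint H)

instance : AddCommGroup P.Half := inferInstanceAs (AddCommGroup P.sqrt.domain)

instance : Module ℂ P.Half := inferInstanceAs (Module ℂ P.sqrt.domain)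

/-- `A^(1/2)` as a linear map `H_{1/2} → H`. -/
def root : P.Half →ₗ[ℂ] H := P.sqrt.toFun

/-- The inclusion `H_{1/2} ⊆ H` as a linear map. -/
def incl : P.Half →ₗ[ℂ] H := P.sqrt.domain.subtype

theorem invSqrt_root (u : P.Half) : P.invSqrt (root P u) = incl P u := P.invSqrt_sqrt u

theorem root_injective : Function.Injective (root P) := fun u v h => by
  refine Subtype.ext ?_
  change incl P u = incl P v
  rw [← invSqrt_root, ← invSqrt_root, h]

instance innerCore : InnerProductSpace.Core ℂ P.Half where
  inner u v := inner ℂ (root P u) (root P v)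
  conj_inner_symm u v := inner_conj_symm _ _
  re_inner_nonneg u := inner_self_nonneg
  add_left u v w := by rw [map_add, inner_add_left]
  smul_left u v r := by rw [map_smul, inner_smul_left]
  definite u h := root_injective P (by rw [inner_self_eq_zero.mp h, map_zero])

instance : NormedAddCommGroup P.Half := (innerCore P).toNormedAddCommGroup

instance : InnerProductSpace ℂ P.Half := InnerProductSpace.ofCore (innerCore P).toCore

theorem inner_def (u v : P.Half) : inner ℂ u v = inner ℂ (root P u) (root P v) := rfl

theorem norm_eq (u : P.Half) : ‖u‖ = ‖root P u‖ := by
  rw [@norm_eq_sqrt_re_inner ℂ, @norm_eq_sqrt_re_inner ℂ _ _ _ _ (root P u), inner_def]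

/-- `H_{1/2}` is a Hilbert space. -/
instance : CompleteSpace P.Half := by
  let e : P.Half ≃ₗᵢ[ℂ] H :=
    { LinearEquiv.ofBijective (root P)
        ⟨root_injective P, fun y => ⟨⟨P.invSqrt y, P.invSqrt_mem y⟩, P.sqrt_invSqrt y⟩⟩ with
      norm_map' := fun u => (norm_eq P u).symm }
  exact e.toIsometryEquiv.completeSpace

/-- The element of `H_{1/2}` given by an element `x ∈ D(A^(1/2))` of `H`. -/
def ofMem {P : PosSelfAdjoint H} (x : H) (hx : x ∈ P.sqrt.domain) : P.Half := ⟨x, hx⟩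

theorem incl_ofMem {P : PosSelfAdjoint H} (x : H) (hx : x ∈ P.sqrt.domain) :
    incl P (ofMem x hx) = x := rfl

/-- The bounded inclusion `H_{1/2} ⊆ H`. -/
def inclL : P.Half →L[ℂ] H :=
  (incl P).mkContinuous ‖P.invSqrt‖ fun u => by
    rw [norm_eq, ← invSqrt_root]
    exact P.invSqrt.le_opNorm _

end Half

theorem op_domain_le_sqrt_domain (P : PosSelfAdjoint H) : P.op.domain ≤ P.sqrt.domain :=
  fun x hx =>
    ⟨P.invSqrt (P.op ⟨x, hx⟩), (P.invSqrt_invSqrt _).trans (P.inv_op ⟨x, hx⟩)⟩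

/-- The inclusion `H_1 = D(A) ⊆ H_{1/2}`. -/
def opToHalf (P : PosSelfAdjoint H) : P.op.domain →ₗ[ℂ] P.Half where
  toFun x := Half.ofMem x (P.op_domain_le_sqrt_domain x.2)
  map_add' _ _ := rfl
  map_smul' _ _ := rfl

/-- The space `H_{-1/2}`, the (anti)dual of `H_{1/2}`. -/
abbrev NegHalf (P : PosSelfAdjoint H) : Type _ := P.Half →L⋆[ℂ] ℂ

/-- The embedding of the pivot space `H ⊆ H_{-1/2}`: `x ↦ (z ↦ ⟪z, x⟫)`. -/
def pivot (P : PosSelfAdjoint H) (x : H) : P.NegHalf :=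
  ((innerSL ℂ).flip x).comp (Half.inclL P)

theorem pivot_apply (P : PosSelfAdjoint H) (x : H) (z : P.Half) :
    P.pivot x z = inner ℂ (Half.incl P z) x := rfl

end PosSelfAdjoint

open PosSelfAdjoint

/-- The adjoint `B* : H_{1/2} → K` of an operator `B : K → H_{-1/2}`, with respect to the duality
between `H_{-1/2}` and `H_{1/2}`: it is characterized by `⟪B* z, k⟫ = (B k)(z)`. -/
def dualAdjoint {H K : Type*} [NormedAddCommGroup H] [InnerProductSpace ℂ H] [CompleteSpace H]
    [NormedAddCommGroup K] [InnerProductSpace ℂ K] [CompleteSpace K] {P : PosSelfAdjoint H}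
    (B : K →L[ℂ] P.NegHalf) : P.Half →L[ℂ] K :=
  ((InnerProductSpace.toDual ℂ K).symm.toContinuousLinearEquiv :
    StrongDual ℂ K →L⋆[ℂ] K).comp B.flip

theorem inner_dualAdjoint {H K : Type*} [NormedAddCommGroup H] [InnerProductSpace ℂ H]
    [CompleteSpace H] [NormedAddCommGroup K] [InnerProductSpace ℂ K] [CompleteSpace K]
    {P : PosSelfAdjoint H} (B : K →L[ℂ] P.NegHalf) (z : P.Half) (k : K) :
    inner ℂ (dualAdjoint B z) k = B k z :=
  InnerProductSpace.toDual_symm_apply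

/-! ## The space `H^τ` -/

/-- The space `H^τ`: the space `H` with the inner product `⟪u, v⟫_τ = τ ⟪u, v⟫`. -/
def Scaled (_τ : {τ : ℝ // 0 < τ}) (H : Type*) : Type _ := H

namespace Scaled

variable (τ : {τ : ℝ // 0 < τ}) (H : Type*) [NormedAddCommGroup H] [InnerProductSpace ℂ H]

instance : AddCommGroup (Scaled τ H) := inferInstanceAs (AddCommGroup H)

instance : Module ℂ (Scaled τ H) := inferInstanceAs (Module ℂ H)

/-- The identity map `H^τ → H`. -/
def toBase : Scaled τ H ≃ₗ[ℂ] H := LinearEquiv.refl ℂ H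

instance innerCore : InnerProductSpace.Core ℂ (Scaled τ H) where
  inner u v := (τ.1 : ℂ) * inner ℂ (toBase τ H u) (toBase τ H v)
  conj_inner_symm u v := by simp
  re_inner_nonneg u := by
    have h : 0 ≤ (inner ℂ (toBase τ H u) (toBase τ H u)).re := inner_self_nonneg (𝕜 := ℂ)
    have hτ := τ.2
    simpa using mul_nonneg hτ.le h
  add_left u v w := by rw [map_add, inner_add_left, mul_add]
  smul_left u v r := by rw [map_smul, inner_smul_left, mul_left_comm]
  definite u h := by
    have hτ : (τ.1 : ℂ) ≠ 0 := by exact_mod_cast τ.2.ne'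
    have h1 : inner ℂ (toBase τ H u) (toBase τ H u) = 0 := (mul_eq_zero.mp h).resolve_left hτ
    exact (toBase τ H).injective (by rw [inner_self_eq_zero.mp h1, map_zero])

instance : NormedAddCommGroup (Scaled τ H) := (innerCore τ H).toNormedAddCommGroup

instance : InnerProductSpace ℂ (Scaled τ H) := InnerProductSpace.ofCore (innerCore τ H).toCore

theorem inner_def (u v : Scaled τ H) :
    inner ℂ u v = (τ.1 : ℂ) * inner ℂ (toBase τ H u) (toBase τ H v) := rfl

end Scaled

/-! ## The abstract thermo-elastic system -/

/-- The data of the abstract thermo-elastic system. The adjoints `A₂*` and `C*` are not part of the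
data. The assumption that `A₂` restricts to an element of `L(H_{1,1/2}, H₂)` says by duality that
`A₂*` extends to an element of `L(H₂, H_{1,-1/2})`; likewise for `C` and `C*`. The restrictions
`A₂half` and `Chalf` are uniquely determined by `A₂` and `C`. -/
structure ThermoElastic (H₁ H₂ : Type*) [NormedAddCommGroup H₁] [InnerProductSpace ℂ H₁]
    [CompleteSpace H₁] [NormedAddCommGroup H₂] [InnerProductSpace ℂ H₂] [CompleteSpace H₂] where
  /-- the positive self-adjoint operator `A₁` on `H₁` -/
  A₁ : PosSelfAdjoint H₁
  /-- the positive self-adjoint operator `A` on `H₂` -/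
  A : PosSelfAdjoint H₂
  /-- the operator `A₂ ∈ L(H₁, H_{2,-1/2})` -/
  A₂ : H₁ →L[ℂ] A.NegHalf
  /-- the restriction of `A₂` to an operator in `L(H_{1,1/2}, H₂)` -/
  A₂half : A₁.Half →L[ℂ] H₂
  A₂half_eq : ∀ w : A₁.Half, A₂ (Half.incl A₁ w) = A.pivot (A₂half w)
  /-- `A₂* ∈ L(H_{2,1/2}, H₁)` restricts to an operator from `H_{2,1} = D(A)` to `H_{1,1/2}` -/
  A₂star_mem : ∀ v : A.op.domain, dualAdjoint A₂ (A.opToHalf v) ∈ A₁.sqrt.domain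
  /-- `A = A₂ A₂*` on `D(A)` -/
  A_eq : ∀ v : A.op.domain, A₂ (dualAdjoint A₂ (A.opToHalf v)) = A.pivot (A.op v)
  /-- the operator `C ∈ L(H₂, H_{1,-1/2})` -/
  C : H₂ →L[ℂ] A₁.NegHalf
  /-- the restriction of `C` to an operator in `L(H_{2,1/2}, H₁)` -/
  Chalf : A.Half →L[ℂ] H₁
  Chalf_eq : ∀ v : A.Half, C (Half.incl A v) = A₁.pivot (Chalf v)

namespace ThermoElastic

variable {H₁ H₂ : Type*} [NormedAddCommGroup H₁] [InnerProductSpace ℂ H₁] [CompleteSpace H₁]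
  [NormedAddCommGroup H₂] [InnerProductSpace ℂ H₂] [CompleteSpace H₂]

/-- `A₂* ∈ L(H_{2,1/2}, H₁)`. -/
def A₂star (S : ThermoElastic H₁ H₂) : S.A.Half →L[ℂ] H₁ := dualAdjoint S.A₂

/-- `C* ∈ L(H_{1,1/2}, H₂)`. -/
def Cstar (S : ThermoElastic H₁ H₂) : S.A₁.Half →L[ℂ] H₂ := dualAdjoint S.C

/-- The Hilbert space `ℋ = H_{1,1/2} × H₁ × H₂ × H₁^τ`, bracketed as
`(H_{1,1/2} × H₁) × (H₂ × H₁^τ)`, with the sum of the inner products of the factors. -/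
abbrev Space (S : ThermoElastic H₁ H₂) (τ : {τ : ℝ // 0 < τ}) : Type _ :=
  WithLp 2 (WithLp 2 (S.A₁.Half × H₁) × WithLp 2 (H₂ × Scaled τ H₁))

/-- The Hilbert space `ℋ₀ = H_{1,1/2} × H₁ × H₂`, bracketed as `(H_{1,1/2} × H₁) × H₂`. -/
abbrev Space₀ (S : ThermoElastic H₁ H₂) : Type _ :=
  WithLp 2 (WithLp 2 (S.A₁.Half × H₁) × H₂)

/-- The element `(u₁, u₂, v, w)` of `ℋ`. -/
def vec (S : ThermoElastic H₁ H₂) (τ : {τ : ℝ // 0 < τ}) (u₁ : S.A₁.Half) (u₂ : H₁) (v : H₂)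
    (w : H₁) : S.Space τ :=
  WithLp.toLp 2 (WithLp.toLp 2 (u₁, u₂), WithLp.toLp 2 (v, (Scaled.toBase τ H₁).symm w))

/-- The element `(u₁, u₂, v)` of `ℋ₀`. -/
def vec₀ (S : ThermoElastic H₁ H₂) (u₁ : S.A₁.Half) (u₂ : H₁) (v : H₂) : S.Space₀ :=
  WithLp.toLp 2 (WithLp.toLp 2 (u₁, u₂), v)

theorem vec_add (S : ThermoElastic H₁ H₂) (τ : {τ : ℝ // 0 < τ}) (u₁ u₁' : S.A₁.Half)
    (u₂ u₂' : H₁) (v v' : H₂) (w w' : H₁) :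
    S.vec τ (u₁ + u₁') (u₂ + u₂') (v + v') (w + w') =
      S.vec τ u₁ u₂ v w + S.vec τ u₁' u₂' v' w' := rfl

theorem vec_smul (S : ThermoElastic H₁ H₂) (τ : {τ : ℝ // 0 < τ}) (c : ℂ) (u₁ : S.A₁.Half)
    (u₂ : H₁) (v : H₂) (w : H₁) :
    S.vec τ (c • u₁) (c • u₂) (c • v) (c • w) = c • S.vec τ u₁ u₂ v w := rfl

theorem vec₀_add (S : ThermoElastic H₁ H₂) (u₁ u₁' : S.A₁.Half) (u₂ u₂' : H₁) (v v' : H₂) :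
    S.vec₀ (u₁ + u₁') (u₂ + u₂') (v + v') = S.vec₀ u₁ u₂ v + S.vec₀ u₁' u₂' v' := rfl

theorem vec₀_smul (S : ThermoElastic H₁ H₂) (c : ℂ) (u₁ : S.A₁.Half) (u₂ : H₁) (v : H₂) :
    S.vec₀ (c • u₁) (c • u₂) (c • v) = c • S.vec₀ u₁ u₂ v := rfl

theorem inner_vec (S : ThermoElastic H₁ H₂) (τ : {τ : ℝ // 0 < τ}) (u₁ u₁' : S.A₁.Half)
    (u₂ u₂' : H₁) (v v' : H₂) (w w' : H₁) :
    inner ℂ (S.vec τ u₁ u₂ v w) (S.vec τ u₁' u₂' v' w') =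
      inner ℂ (Half.root S.A₁ u₁) (Half.root S.A₁ u₁') + inner ℂ u₂ u₂' + inner ℂ v v'
        + (τ.1 : ℂ) * inner ℂ w w' := by
  simp only [vec, WithLp.prod_inner_apply, Half.inner_def, Scaled.inner_def,
    LinearEquiv.apply_symm_apply]
  ring

theorem inner_vec₀ (S : ThermoElastic H₁ H₂) (u₁ u₁' : S.A₁.Half) (u₂ u₂' : H₁) (v v' : H₂) :
    inner ℂ (S.vec₀ u₁ u₂ v) (S.vec₀ u₁' u₂' v') =
      inner ℂ (Half.root S.A₁ u₁) (Half.root S.A₁ u₁') + inner ℂ u₂ u₂' + inner ℂ v v' := by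
  simp only [vec₀, WithLp.prod_inner_apply, Half.inner_def]

/-- The domain `D(𝒜_d) = H_{1,1} × H_{1,1/2} × H_{2,1/2} × H_{1,1/2}` in `ℋ`. -/
def domainD (S : ThermoElastic H₁ H₂) (τ : {τ : ℝ // 0 < τ}) : Submodule ℂ (S.Space τ) where
  carrier := {W | Half.incl S.A₁ W.fst.fst ∈ S.A₁.op.domain ∧ W.fst.snd ∈ S.A₁.sqrt.domain ∧
    W.snd.fst ∈ S.A.sqrt.domain ∧ Scaled.toBase τ H₁ W.snd.snd ∈ S.A₁.sqrt.domain}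
  add_mem' := fun ⟨a1, a2, a3, a4⟩ ⟨b1, b2, b3, b4⟩ => by
    refine ⟨?_, add_mem a2 b2, add_mem a3 b3, ?_⟩
    · simpa using add_mem a1 b1
    · simpa using add_mem a4 b4
  zero_mem' := by
    refine ⟨?_, zero_mem _, zero_mem _, ?_⟩
    · simp
    · simp
  smul_mem' := fun c _ ⟨a1, a2, a3, a4⟩ => by
    refine ⟨?_, Submodule.smul_mem _ c a2, Submodule.smul_mem _ c a3, ?_⟩
    · simpa using Submodule.smul_mem _ c a1
    · simpa using Submodule.smul_mem _ c a4

/-- The component `u₁ ∈ H_{1,1}` of an element of `D(𝒜_d)`. -/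
def compD₁ (S : ThermoElastic H₁ H₂) (τ : {τ : ℝ // 0 < τ}) :
    S.domainD τ →ₗ[ℂ] S.A₁.op.domain where
  toFun W := ⟨Half.incl S.A₁ W.1.fst.fst, W.2.1⟩
  map_add' _ _ := rfl
  map_smul' _ _ := rfl

/-- The component `u₂ ∈ H_{1,1/2}` of an element of `D(𝒜_d)`. -/
def compD₂ (S : ThermoElastic H₁ H₂) (τ : {τ : ℝ // 0 < τ}) :
    S.domainD τ →ₗ[ℂ] S.A₁.Half where
  toFun W := Half.ofMem W.1.fst.snd W.2.2.1
  map_add' _ _ := rfl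
  map_smul' _ _ := rfl

/-- The component `v ∈ H_{2,1/2}` of an element of `D(𝒜_d)`. -/
def compD₃ (S : ThermoElastic H₁ H₂) (τ : {τ : ℝ // 0 < τ}) :
    S.domainD τ →ₗ[ℂ] S.A.Half where
  toFun W := Half.ofMem W.1.snd.fst W.2.2.2.1
  map_add' _ _ := rfl
  map_smul' _ _ := rfl

/-- The component `w ∈ H_{1,1/2}` of an element of `D(𝒜_d)`. -/
def compD₄ (S : ThermoElastic H₁ H₂) (τ : {τ : ℝ // 0 < τ}) :
    S.domainD τ →ₗ[ℂ] S.A₁.Half where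
  toFun W := Half.ofMem (Scaled.toBase τ H₁ W.1.snd.snd) W.2.2.2.2
  map_add' _ _ := rfl
  map_smul' _ _ := rfl

/-- The operator `𝒜_d (u₁, u₂, v, w) =
(u₂, -A₁ u₁ - C v, C* u₂ - A₂ w, (1/τ) A₂* v - (1/τ) w)` with domain
`H_{1,1} × H_{1,1/2} × H_{2,1/2} × H_{1,1/2}`. -/
def opD (S : ThermoElastic H₁ H₂) (τ : {τ : ℝ // 0 < τ}) : S.Space τ →ₗ.[ℂ] S.Space τ where
  domain := S.domainD τ
  toFun :=
    { toFun := fun W =>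
        S.vec τ (S.compD₂ τ W)
          (-S.A₁.op (S.compD₁ τ W) - S.Chalf (S.compD₃ τ W))
          (S.Cstar (S.compD₂ τ W) - S.A₂half (S.compD₄ τ W))
          ((τ.1 : ℂ)⁻¹ • S.A₂star (S.compD₃ τ W)
            - (τ.1 : ℂ)⁻¹ • Half.incl S.A₁ (S.compD₄ τ W))
      map_add' := fun W W' => by
        simp only [map_add, LinearPMap.map_add, smul_add, ← S.vec_add]
        congr 1 <;> abel
      map_smul' := fun c W => by
        simp only [map_smul, LinearPMap.map_smul, RingHom.id_apply, ← S.vec_smul, smul_sub,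
          smul_neg, smul_comm c] }

/-- The domain `D(𝒜) = H_{1,1} × H_{1,1/2} × H_{2,1}` in `ℋ₀`. -/
def domain₀ (S : ThermoElastic H₁ H₂) : Submodule ℂ S.Space₀ where
  carrier := {W | Half.incl S.A₁ W.fst.fst ∈ S.A₁.op.domain ∧ W.fst.snd ∈ S.A₁.sqrt.domain ∧
    W.snd ∈ S.A.op.domain}
  add_mem' := fun ⟨a1, a2, a3⟩ ⟨b1, b2, b3⟩ => by
    refine ⟨?_, add_mem a2 b2, add_mem a3 b3⟩
    simpa using add_mem a1 b1
  zero_mem' := by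
    refine ⟨?_, zero_mem _, zero_mem _⟩
    simp
  smul_mem' := fun c _ ⟨a1, a2, a3⟩ => by
    refine ⟨?_, Submodule.smul_mem _ c a2, Submodule.smul_mem _ c a3⟩
    simpa using Submodule.smul_mem _ c a1

/-- The component `u₁ ∈ H_{1,1}` of an element of `D(𝒜)`. -/
def comp₁ (S : ThermoElastic H₁ H₂) : S.domain₀ →ₗ[ℂ] S.A₁.op.domain where
  toFun W := ⟨Half.incl S.A₁ W.1.fst.fst, W.2.1⟩
  map_add' _ _ := rfl
  map_smul' _ _ := rfl

/-- The component `u₂ ∈ H_{1,1/2}` of an element of `D(𝒜)`. -/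
def comp₂ (S : ThermoElastic H₁ H₂) : S.domain₀ →ₗ[ℂ] S.A₁.Half where
  toFun W := Half.ofMem W.1.fst.snd W.2.2.1
  map_add' _ _ := rfl
  map_smul' _ _ := rfl

/-- The component `v ∈ H_{2,1}` of an element of `D(𝒜)`. -/
def comp₃ (S : ThermoElastic H₁ H₂) : S.domain₀ →ₗ[ℂ] S.A.op.domain where
  toFun W := ⟨W.1.snd, W.2.2.2⟩
  map_add' _ _ := rfl
  map_smul' _ _ := rfl

/-- The operator `𝒜 (u₁, u₂, v) = (u₂, -A₁ u₁ - C v, C* u₂ - A v)` with domain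
`H_{1,1} × H_{1,1/2} × H_{2,1}`. -/
def op₀ (S : ThermoElastic H₁ H₂) : S.Space₀ →ₗ.[ℂ] S.Space₀ where
  domain := S.domain₀
  toFun :=
    { toFun := fun W =>
        S.vec₀ (S.comp₂ W)
          (-S.A₁.op (S.comp₁ W) - S.Chalf (S.A.opToHalf (S.comp₃ W)))
          (S.Cstar (S.comp₂ W) - S.A.op (S.comp₃ W))
      map_add' := fun W W' => by
        simp only [map_add, LinearPMap.map_add, ← S.vec₀_add]
        congr 1 <;> abel
      map_smul' := fun c W => by
        simp only [map_smul, LinearPMap.map_smul, RingHom.id_apply, ← S.vec₀_smul, smul_sub,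
          smul_neg] }

/-- The natural domain `{w ∈ H₁ : A₂ w ∈ H₂}` of `A₂`, as an unbounded operator from `H₁` to `H₂`,
is `H_{1,1/2}` (which is always contained in it). -/
def A₂DomainEqHalf (S : ThermoElastic H₁ H₂) : Prop :=
  ∀ w : H₁, (∃ f : H₂, S.A₂ w = S.A.pivot f) → w ∈ S.A₁.sqrt.domain

end ThermoElastic

end

/-!
By the Lumer–Phillips theorem, a densely defined operator `B` generates a contraction semigroup as
soon as it is dissipative and `1 - B` is onto. Both operators are skew apart from the damping terms
`-⟪A v, v⟫` and `-‖w‖²`, hence dissipative and therefore closable. Eliminating `u₁` and `w` from the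
resolvent equation leaves a system for `(u₂, v)` which is skew apart from a coercive diagonal, and
which is solved through its Schur complement. For `𝒜_d` the resulting `w` lies in the natural domain
of `A₂` only. Since `A = A₂ A₂*`, the map `A₂*` embeds `H_{2,1/2}` isometrically into `H₁`, and
projecting along its range approximates such a `w` by elements `u` of `H_{1,1/2}` with the same
value `A₂ u = A₂ w`. So the closure of `𝒜_d` admits all these `w`, and `𝒜_d` itself can be closed,
as every generator is, only when they already belong to `H_{1,1/2}`.
-/

noncomputable section

/-! ## The Lumer–Phillips theorem -/

section Exponential

variable {𝔸 : Type*} [NormedRing 𝔸] [NormedAlgebra ℝ 𝔸]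

theorem norm_exp_smul_le (h1 : ‖(1 : 𝔸)‖ ≤ 1) {a : 𝔸} (ha : ‖a‖ ≤ 1) {s : ℝ} (hs : 0 ≤ s) :
    ‖NormedSpace.exp (s • a)‖ ≤ Real.exp s := by
  have hpow : ∀ n : ℕ, ‖a ^ n‖ ≤ 1 := fun n => by
    induction n with
    | zero => rwa [pow_zero]
    | succ n ih => rw [pow_succ]; exact (norm_mul_le _ _).trans (mul_le_one₀ ih (norm_nonneg _) ha)
  have hsum : HasSum (fun n : ℕ => s ^ n / n.factorial) (Real.exp s) := by
    rw [Real.exp_eq_exp_ℝ]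
    exact NormedSpace.expSeries_div_hasSum_exp s
  rw [NormedSpace.exp_eq_tsum ℝ]
  refine tsum_of_norm_bounded hsum fun n => ?_
  rw [smul_pow, smul_smul, norm_smul, Real.norm_of_nonneg (by positivity), inv_mul_eq_div]
  exact mul_le_of_le_one_right (by positivity) (hpow n)

variable [CompleteSpace 𝔸]

theorem norm_exp_smul_sub_one_le (h1 : ‖(1 : 𝔸)‖ ≤ 1) {a : 𝔸} (ha : ‖a‖ ≤ 1) {s : ℝ}
    (hs : 0 ≤ s) : ‖NormedSpace.exp (s • (a - 1))‖ ≤ 1 := by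
  let := NormedAlgebra.restrictScalars ℚ ℝ 𝔸
  have hsplit : s • (a - 1) = algebraMap ℝ 𝔸 (-s) + s • a := by
    rw [Algebra.algebraMap_eq_smul_one]; module
  rw [hsplit, NormedSpace.exp_add_of_commute (Algebra.commutes _ _),
    ← NormedSpace.algebraMap_exp_comm, Algebra.algebraMap_eq_smul_one, smul_mul_assoc, one_mul,
    norm_smul, ← Real.exp_eq_exp_ℝ, Real.norm_of_nonneg (Real.exp_pos _).le, Real.exp_neg,
    inv_mul_le_one₀ (Real.exp_pos _)]
  exact norm_exp_smul_le h1 ha hs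

theorem hasDerivAt_exp_smul_mul_exp_sub_smul {a b : 𝔸} (hab : Commute a b) (t s : ℝ) :
    HasDerivAt (fun s : ℝ => NormedSpace.exp (s • a) * NormedSpace.exp ((t - s) • b))
      (NormedSpace.exp (s • a) * NormedSpace.exp ((t - s) • b) * (a - b)) s := by
  let := NormedAlgebra.restrictScalars ℚ ℝ 𝔸
  have hleft := hasDerivAt_exp_smul_const (𝕂 := ℝ) a s
  have hright : HasDerivAt (fun s : ℝ => NormedSpace.exp ((t - s) • b))
      (-(NormedSpace.exp ((t - s) • b) * b)) s :=
    (hasDerivAt_exp_smul_const (𝕂 := ℝ) b (t - s)).comp_const_sub t s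
  have hcomm : Commute a (NormedSpace.exp ((t - s) • b)) := (hab.smul_right _).exp_right
  refine (hleft.mul hright).congr_deriv ?_
  rw [mul_assoc, hcomm.eq]
  noncomm_ring

variable {X : Type*} [NormedAddCommGroup X] [NormedSpace ℂ X] [CompleteSpace X]

theorem hasDerivAt_exp_smul_apply (P : X →L[ℂ] X) (x : X) (t : ℝ) :
    HasDerivAt (fun s : ℝ => NormedSpace.exp (s • P) x) (NormedSpace.exp (t • P) (P x)) t :=
  ((ContinuousLinearMap.apply ℂ X x).restrictScalars ℝ).hasFDerivAt.comp_hasDerivAt t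
    (hasDerivAt_exp_smul_const (𝕂 := ℝ) P t)

theorem norm_exp_smul_sub_exp_smul_le {P Q : X →L[ℂ] X} (hPQ : Commute P Q)
    (hP : ∀ s : ℝ, 0 ≤ s → ‖NormedSpace.exp (s • P)‖ ≤ 1)
    (hQ : ∀ s : ℝ, 0 ≤ s → ‖NormedSpace.exp (s • Q)‖ ≤ 1) {t : ℝ} (ht : 0 ≤ t) (x : X) :
    ‖NormedSpace.exp (t • P) x - NormedSpace.exp (t • Q) x‖ ≤ t * ‖P x - Q x‖ := by
  let R : ℝ → X →L[ℂ] X := fun s => NormedSpace.exp (s • P) * NormedSpace.exp ((t - s) • Q)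
  have hderiv : ∀ s, HasDerivAt (fun s => R s x) (R s (P x - Q x)) s := fun s =>
    ((ContinuousLinearMap.apply ℂ X x).restrictScalars ℝ).hasFDerivAt.comp_hasDerivAt s
      (hasDerivAt_exp_smul_mul_exp_sub_smul hPQ t s)
  have hbound : ∀ s ∈ Set.Ico 0 t, ‖R s (P x - Q x)‖ ≤ ‖P x - Q x‖ := fun s hs =>
    ((R s).le_opNorm _).trans <| mul_le_of_le_one_left (norm_nonneg _) <|
      (norm_mul_le _ _).trans <| mul_le_one₀ (hP s hs.1) (norm_nonneg _) <|
        hQ _ (sub_nonneg.2 hs.2.le)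
  have hR := norm_image_sub_le_of_norm_deriv_le_segment'
    (fun s _ => (hderiv s).hasDerivWithinAt) hbound t ⟨ht, le_rfl⟩
  simpa [R, mul_comm] using hR

end Exponential

namespace ContractionSemigroup

variable {X : Type*} [NormedAddCommGroup X] [NormedSpace ℂ X] (S : ContractionSemigroup X)

theorem norm_apply_le (t : ℝ≥0) (x : X) : ‖S.T t x‖ ≤ ‖x‖ :=
  (S.T t).le_of_opNorm_le_of_le (S.contraction t) le_rfl |>.trans_eq (one_mul _)

/-- The trajectory `t ↦ T t x`, extended to negative times by the constant `x` so that calculus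
on `ℝ` applies to it. -/
def orbit (x : X) (t : ℝ) : X := S.T t.toNNReal x

@[simp]
theorem orbit_zero (x : X) : S.orbit x 0 = x := by simp [orbit, S.map_zero]

theorem continuous_orbit (x : X) : Continuous (S.orbit x) :=
  (S.strongly_continuous x).comp continuous_real_toNNReal

theorem continuous_uncurry_orbit : Continuous (Function.uncurry S.orbit) :=
  continuous_prod_of_continuous_lipschitzWith _ 1
    (fun x => S.continuous_orbit x)
    fun t => (S.T t.toNNReal).lipschitz.weaken (S.contraction _)

theorem orbit_add (x : X) {s t : ℝ} (hs : 0 ≤ s) (ht : 0 ≤ t) :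
    S.orbit x (s + t) = S.T s.toNNReal (S.orbit x t) := by
  rw [orbit, Real.toNNReal_add hs ht, S.map_add]; rfl

theorem tendsto_difference_quotient_iff {x y : X} :
    Tendsto (fun h : ℝ≥0 => ((h : ℝ)⁻¹ : ℂ) • (S.T h x - x)) (𝓝[>] 0) (𝓝 y) ↔
      HasDerivWithinAt (S.orbit x) y (Set.Ici 0) 0 := by
  rw [← hasDerivWithinAt_Ioi_iff_Ici, hasDerivWithinAt_iff_tendsto_slope' Set.self_notMem_Ioi,
    ← NNReal.coe_zero, ← NNReal.map_coe_nhdsGT, tendsto_map'_iff]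
  refine tendsto_congr fun h => ?_
  rw [Function.comp_apply, slope_def_module, NNReal.coe_zero, sub_zero, orbit_zero, orbit,
    Real.toNNReal_coe, ← Complex.ofReal_inv, Complex.coe_smul]

theorem hasDerivWithinAt_orbit {x y : X} (hxy : HasDerivWithinAt (S.orbit x) y (Set.Ici 0) 0)
    {t : ℝ} (ht : 0 ≤ t) : HasDerivWithinAt (S.orbit x) (S.orbit y t) (Set.Ici t) t := by
  have hsub : HasDerivWithinAt (fun s : ℝ => s - t) 1 (Set.Ici t) t :=
    ((hasDerivAt_id' t).sub_const t).hasDerivWithinAt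
  have hshift : HasDerivWithinAt (fun s => S.orbit x (s - t)) y (Set.Ici t) t := by
    have h := hxy.scomp_of_eq t hsub (fun _ hs => Set.mem_Ici.2 (sub_nonneg.2 hs))
      (sub_self t).symm
    rwa [one_smul] at h
  refine (((S.T t.toNNReal).restrictScalars ℝ).hasFDerivAt.comp_hasDerivWithinAt t hshift).congr
    (fun s hs => ?_) ?_
  · simpa using S.orbit_add x ht (sub_nonneg.2 hs)
  · simpa using S.orbit_add x ht le_rfl

variable [CompleteSpace X]

theorem hasDerivWithinAt_orbit_zero_iff {x y : X} :
    HasDerivWithinAt (S.orbit x) y (Set.Ici 0) 0 ↔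
      ∀ t, 0 ≤ t → S.orbit x t - x = ∫ s in 0..t, S.orbit y s := by
  have hint : ∀ t, IntervalIntegrable (S.orbit y) MeasureTheory.volume 0 t := fun t =>
    (S.continuous_orbit y).intervalIntegrable 0 t
  refine ⟨fun hxy t ht => ?_, fun hxy => ?_⟩
  · rw [intervalIntegral.integral_eq_sub_of_hasDeriv_right_of_le ht
      (S.continuous_orbit x).continuousOn
      (fun s hs => (S.hasDerivWithinAt_orbit hxy hs.1.le).mono Set.Ioi_subset_Ici_self) (hint t),
      orbit_zero]
  · have hderiv : HasDerivWithinAt (fun t => x + ∫ s in 0..t, S.orbit y s) (S.orbit y 0)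
        (Set.Ici 0) 0 :=
      ((intervalIntegral.integral_hasDerivAt_right (hint 0)
        ((S.continuous_orbit y).stronglyMeasurableAtFilter _ _)
        (S.continuous_orbit y).continuousAt).const_add x).hasDerivWithinAt
    rw [orbit_zero] at hderiv
    exact hderiv.congr (fun t ht => eq_add_of_sub_eq' (hxy t ht)) (by simp)

theorem IsGenerator.mem_graph_iff {S : ContractionSemigroup X} {B : X →ₗ.[ℂ] X}
    (hB : S.IsGenerator B) {x y : X} :
    (x, y) ∈ B.graph ↔ ∀ t, 0 ≤ t → S.orbit x t - x = ∫ s in 0..t, S.orbit y s := by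
  rw [hB, S.tendsto_difference_quotient_iff, S.hasDerivWithinAt_orbit_zero_iff]

end ContractionSemigroup

theorem GeneratesContractionSemigroup.isClosed {X : Type*} [NormedAddCommGroup X]
    [NormedSpace ℂ X] [CompleteSpace X] {B : X →ₗ.[ℂ] X} (hB : GeneratesContractionSemigroup B) :
    B.IsClosed := by
  obtain ⟨S, hS⟩ := hB
  have hgraph : (B.graph : Set (X × X)) =
      {z | ∀ t, 0 ≤ t → S.orbit z.1 t - z.1 = ∫ s in 0..t, S.orbit z.2 s} :=
    Set.ext fun _ => hS.mem_graph_iff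
  rw [LinearPMap.IsClosed, hgraph]
  simp only [Set.ofPred_forall]
  refine isClosed_iInter fun t => isClosed_iInter fun _ => isClosed_eq ?_ ?_
  · exact ((S.T t.toNNReal).continuous.comp continuous_fst).sub continuous_fst
  · exact (intervalIntegral.continuous_parametric_intervalIntegral_of_continuous'
      S.continuous_uncurry_orbit 0 t).comp continuous_snd

theorem ContractionSemigroup.mul_norm_le_norm_smul_sub {X : Type*} [NormedAddCommGroup X]
    [NormedSpace ℂ X] (S : ContractionSemigroup X) {x y : X}
    (hxy : Tendsto (fun h : ℝ≥0 => ((h : ℝ)⁻¹ : ℂ) • (S.T h x - x)) (𝓝[>] 0) (𝓝 y)) (l : ℝ) :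
    l * ‖x‖ ≤ ‖(l : ℂ) • x - y‖ := by
  refine ge_of_tendsto ((tendsto_const_nhds.sub hxy).norm) ?_
  filter_upwards [self_mem_nhdsWithin] with h hh
  have hpos : (0 : ℝ) < h := hh
  have hsplit : (l : ℂ) • x - ((h : ℝ)⁻¹ : ℂ) • (S.T h x - x)
      = ((l + (h : ℝ)⁻¹ : ℝ) : ℂ) • x - ((h : ℝ)⁻¹ : ℂ) • S.T h x := by
    push_cast; module
  have hx : ‖((l + (h : ℝ)⁻¹ : ℝ) : ℂ) • x‖ ≥ (l + (h : ℝ)⁻¹) * ‖x‖ := by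
    rw [norm_smul, Complex.norm_real]
    exact mul_le_mul_of_nonneg_right (Real.le_norm_self _) (norm_nonneg _)
  have hTx : ‖((h : ℝ)⁻¹ : ℂ) • S.T h x‖ ≤ (h : ℝ)⁻¹ * ‖x‖ := by
    rw [norm_smul, norm_inv, Complex.norm_real, Real.norm_of_nonneg hpos.le]
    exact mul_le_mul_of_nonneg_left (S.norm_apply_le h x) (by positivity)
  rw [hsplit]
  linarith [norm_sub_norm_le (((l + (h : ℝ)⁻¹ : ℝ) : ℂ) • x) (((h : ℝ)⁻¹ : ℂ) • S.T h x)]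

section StrongLimits

variable {α β : Type*} [PseudoMetricSpace α] [PseudoMetricSpace β]

theorem tendsto_apply_of_lipschitzWith {f : ℕ → α → β} {K : ℝ≥0} (hf : ∀ n, LipschitzWith K (f n))
    {x : ℕ → α} {a : α} {b : β} (hx : Tendsto x atTop (𝓝 a))
    (ha : Tendsto (fun n => f n a) atTop (𝓝 b)) : Tendsto (fun n => f n (x n)) atTop (𝓝 b) := by
  refine ha.congr_dist
    (squeeze_zero (fun _ => dist_nonneg) (fun n => (hf n).dist_le_mul a (x n)) ?_)
  simpa [dist_comm] using (tendsto_iff_dist_tendsto_zero.1 hx).const_mul (K : ℝ)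

theorem cauchySeq_apply_of_dense {f : ℕ → α → β} (hf : ∀ n, LipschitzWith 1 (f n)) {s : Set α}
    (hs : Dense s) (hfs : ∀ a ∈ s, CauchySeq fun n => f n a) (a : α) :
    CauchySeq fun n => f n a := by
  refine Metric.cauchySeq_iff.2 fun ε hε => ?_
  obtain ⟨b, hab, hb⟩ := Metric.dense_iff.1 hs a (ε / 3) (by positivity)
  obtain ⟨N, hN⟩ := Metric.cauchySeq_iff.1 (hfs b hb) (ε / 3) (by positivity)
  refine ⟨N, fun m hm n hn => ?_⟩
  have hclose : ∀ k, dist (f k a) (f k b) < ε / 3 := fun k =>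
    (by simpa using (hf k).dist_le_mul a b : _ ≤ dist a b).trans_lt (by rwa [dist_comm])
  calc dist (f m a) (f n a)
      ≤ dist (f m a) (f m b) + dist (f m b) (f n b) + dist (f n b) (f n a) := dist_triangle4 ..
    _ < ε / 3 + ε / 3 + ε / 3 :=
        add_lt_add (add_lt_add (hclose m) (hN m hm n hn)) (dist_comm (f n a) _ ▸ hclose n)
    _ = ε := by ring

end StrongLimits

/-- Dissipativity of an operator on a Banach space, in its norm form. On a Hilbert space it follows
from `Re ⟪B x, x⟫ ≤ 0`, see `isDissipative_of_re_inner_nonpos`. -/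
def IsDissipative {X : Type*} [NormedAddCommGroup X] [NormedSpace ℂ X] (B : X →ₗ.[ℂ] X) : Prop :=
  ∀ l : ℝ, 0 < l → ∀ x : B.domain, l * ‖(x : X)‖ ≤ ‖(l : ℂ) • (x : X) - B x‖

theorem isDissipative_of_re_inner_nonpos {X : Type*} [NormedAddCommGroup X]
    [InnerProductSpace ℂ X] {B : X →ₗ.[ℂ] X}
    (hB : ∀ x : B.domain, (inner ℂ (B x) (x : X)).re ≤ 0) : IsDissipative B := by
  intro l _ x
  rcases (norm_nonneg (x : X)).eq_or_lt with hx | hx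
  · simp [← hx]
  refine le_of_mul_le_mul_right ?_ hx
  calc l * ‖(x : X)‖ * ‖(x : X)‖
      ≤ l * ‖(x : X)‖ ^ 2 - (inner ℂ (B x) (x : X)).re := by linarith [hB x]
    _ = (inner ℂ ((l : ℂ) • (x : X) - B x) (x : X)).re := by
        rw [inner_sub_left, inner_smul_left, inner_self_eq_norm_sq_to_K]
        simp [← Complex.ofReal_pow]
    _ ≤ ‖(l : ℂ) • (x : X) - B x‖ * ‖(x : X)‖ := re_inner_le_norm (𝕜 := ℂ) _ _

/-- A dissipative operator `B` such that `1 - B` is onto; by `IsMaxDissipative.surjective` all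
`l - B` with `l > 0` are then onto. -/
structure IsMaxDissipative {X : Type*} [NormedAddCommGroup X] [NormedSpace ℂ X]
    (B : X →ₗ.[ℂ] X) : Prop where
  isDissipative : IsDissipative B
  surjective_one_sub : Function.Surjective fun x : B.domain => (x : X) - B x

section Dissipative

variable {X : Type*} [NormedAddCommGroup X] [NormedSpace ℂ X] {B : X →ₗ.[ℂ] X}

namespace IsDissipative

theorem mul_norm_le_of_mem_graph (hB : IsDissipative B) {l : ℝ} (hl : 0 < l) {z : X × X}
    (hz : z ∈ B.graph) : l * ‖z.1‖ ≤ ‖(l : ℂ) • z.1 - z.2‖ := by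
  obtain ⟨x, hx₁, hx₂⟩ := (LinearPMap.mem_graph_iff _).1 hz
  rw [← hx₁, ← hx₂]
  exact hB l hl x

theorem mul_norm_le_of_mem_topologicalClosure (hB : IsDissipative B) {l : ℝ} (hl : 0 < l)
    {z : X × X} (hz : z ∈ B.graph.topologicalClosure) :
    l * ‖z.1‖ ≤ ‖(l : ℂ) • z.1 - z.2‖ := by
  have hclosed : IsClosed {z : X × X | l * ‖z.1‖ ≤ ‖(l : ℂ) • z.1 - z.2‖} :=
    isClosed_le (by fun_prop) (by fun_prop)
  exact closure_minimal (fun _ hz => hB.mul_norm_le_of_mem_graph hl hz) hclosed hz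

theorem norm_le_norm_sub_of_zero_mem_topologicalClosure (hB : IsDissipative B) {y : X}
    (hy : (0, y) ∈ B.graph.topologicalClosure) (u : B.domain) : ‖(u : X)‖ ≤ ‖(u : X) - y‖ := by
  have hl : ∀ l : ℝ, 0 < l → ‖(u : X)‖ ≤ ‖(u : X) - y‖ + ‖B u‖ / l := fun l hl => by
    have hmem := B.graph.topologicalClosure.add_mem
      (B.graph.le_topologicalClosure (B.mem_graph u))
      (B.graph.topologicalClosure.smul_mem (l : ℂ) hy)
    have hle : l * ‖(u : X)‖ ≤ ‖(l : ℂ) • ((u : X) - y) - B u‖ := by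
      have h := hB.mul_norm_le_of_mem_topologicalClosure hl hmem
      simp only [Prod.smul_mk, Prod.mk_add_mk, smul_zero, add_zero] at h
      rwa [sub_add_eq_sub_sub_swap, ← smul_sub] at h
    rw [← mul_le_mul_iff_right₀ hl, mul_add, mul_div_cancel₀ _ hl.ne']
    refine hle.trans ((norm_sub_le _ _).trans_eq ?_)
    rw [norm_smul, Complex.norm_real, Real.norm_of_nonneg hl.le]
  have hlim : Tendsto (fun l : ℝ => ‖(u : X) - y‖ + ‖B u‖ / l) atTop (𝓝 ‖(u : X) - y‖) := by
    simpa using (tendsto_const_nhds (x := ‖B u‖)).div_atTop tendsto_id |>.const_add ‖(u : X) - y‖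
  exact ge_of_tendsto hlim ((eventually_gt_atTop 0).mono hl)

theorem isClosable (hB : IsDissipative B) (hD : Dense (B.domain : Set X)) : B.IsClosable := by
  refine ⟨_, (Submodule.toLinearPMap_graph_eq B.graph.topologicalClosure ?_).symm⟩
  rintro ⟨x, y⟩ hxy hx
  obtain rfl : x = 0 := hx
  have hle : ∀ u, ‖u‖ ≤ ‖u - y‖ :=
    hD.induction (fun u hu => hB.norm_le_norm_sub_of_zero_mem_topologicalClosure hxy ⟨u, hu⟩)
      (isClosed_le (by fun_prop) (by fun_prop))
  simpa using hle y

theorem closure (hB : IsDissipative B) (hc : B.IsClosable) : IsDissipative B.closure := by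
  intro l hl x
  have hx := B.closure.mem_graph x
  rw [← hc.graph_closure_eq_closure_graph] at hx
  exact hB.mul_norm_le_of_mem_topologicalClosure hl hx

theorem surjective_of_lt_two_mul [CompleteSpace X] (hB : IsDissipative B) {l m : ℝ} (hl : 0 < l)
    (hlm : l < 2 * m) (hm : Function.Surjective fun x : B.domain => (m : ℂ) • (x : X) - B x) :
    Function.Surjective fun x : B.domain => (l : ℂ) • (x : X) - B x := by
  intro y
  have hm0 : 0 < m := by linarith
  choose R hR using hm
  have hRlip : ∀ a b, m * ‖(R a : X) - R b‖ ≤ ‖a - b‖ := fun a b => by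
    have h := hB m hm0 (R a - R b)
    rw [LinearPMap.map_sub, AddSubgroupClass.coe_sub, smul_sub, sub_sub_sub_comm] at h
    exact h.trans_eq (congrArg₂ (fun u v => ‖u - v‖) (hR a) (hR b))
  -- `l x - B x = y` is the fixed point equation `x = R (y + (m - l) x)`.
  let Φ : X → X := fun x => R (y + ((m - l : ℝ) : ℂ) • x)
  have hΦ : ContractingWith (|m - l| / m).toNNReal Φ := by
    refine ⟨Real.toNNReal_lt_one.2 ((div_lt_one hm0).2 (abs_lt.2 ⟨by linarith, by linarith⟩)),
      LipschitzWith.of_dist_le_mul fun a b => ?_⟩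
    rw [Real.coe_toNNReal _ (by positivity), dist_eq_norm, dist_eq_norm, div_mul_eq_mul_div,
      le_div_iff₀' hm0]
    refine (hRlip _ _).trans_eq ?_
    rw [add_sub_add_left_eq_sub, ← smul_sub, norm_smul, Complex.norm_real, Real.norm_eq_abs]
  have : Nonempty X := ⟨0⟩
  obtain ⟨x, hx⟩ : ∃ x, Φ x = x := ⟨_, hΦ.fixedPoint_isFixedPt⟩
  obtain ⟨r, hr⟩ : ∃ r : B.domain, (m : ℂ) • (r : X) - B r = y + ((m - l : ℝ) : ℂ) • (r : X) :=
    ⟨R (y + ((m - l : ℝ) : ℂ) • x), (hR _).trans (by rw [show (R _ : X) = x from hx])⟩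
  refine ⟨r, ?_⟩
  calc (l : ℂ) • (r : X) - B r
      = ((m : ℂ) • (r : X) - B r) - ((m - l : ℝ) : ℂ) • (r : X) := by push_cast; module
    _ = y := by rw [hr, add_sub_cancel_right]

theorem isMaxDissipative (hB : IsDissipative B) (h : ∀ y, ∃ z ∈ B.graph, z.1 - z.2 = y) :
    IsMaxDissipative B where
  isDissipative := hB
  surjective_one_sub y := by
    obtain ⟨_, hz, rfl⟩ := h y
    obtain ⟨x, hx₁, hx₂⟩ := (LinearPMap.mem_graph_iff _).1 hz
    exact ⟨x, congrArg₂ (· - ·) hx₁ hx₂⟩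

end IsDissipative

namespace IsMaxDissipative

variable [CompleteSpace X] (hB : IsMaxDissipative B)
include hB

theorem surjective {l : ℝ} (hl : 0 < l) :
    Function.Surjective fun x : B.domain => (l : ℂ) • (x : X) - B x := by
  have hpow : ∀ n : ℕ, Function.Surjective
      fun x : B.domain => (((3 / 2 : ℝ) ^ n : ℝ) : ℂ) • (x : X) - B x := fun n => by
    induction n with
    | zero => simpa using hB.surjective_one_sub
    | succ n ih =>
      refine hB.isDissipative.surjective_of_lt_two_mul (by positivity) ?_ ih
      rw [pow_succ, mul_comm]
      exact mul_lt_mul_of_pos_right (by norm_num) (by positivity)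
  obtain ⟨n, hn⟩ := pow_unbounded_of_one_lt l (by norm_num : (1 : ℝ) < 3 / 2)
  exact hB.isDissipative.surjective_of_lt_two_mul hl (by linarith) (hpow n)

theorem bijective {l : ℝ} (hl : 0 < l) :
    Function.Bijective ((l : ℂ) • B.domain.subtype - B.toFun) := by
  refine ⟨(injective_iff_map_eq_zero _).2 fun x hx => ?_, hB.surjective hl⟩
  have hle : l * ‖(x : X)‖ ≤ ‖((l : ℂ) • B.domain.subtype - B.toFun) x‖ := hB.isDissipative l hl x
  rw [hx, norm_zero] at hle
  exact Subtype.ext (norm_le_zero_iff.1 (nonpos_of_mul_nonpos_right hle hl))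

/-- The resolvent `(l - B)⁻¹`. -/
def resolvent {l : ℝ} (hl : 0 < l) : X →ₗ[ℂ] X :=
  B.domain.subtype ∘ₗ (LinearEquiv.ofBijective _ (hB.bijective hl)).symm.toLinearMap

theorem resolvent_mem_graph {l : ℝ} (hl : 0 < l) (y : X) :
    (hB.resolvent hl y, (l : ℂ) • hB.resolvent hl y - y) ∈ B.graph := by
  let x := (LinearEquiv.ofBijective _ (hB.bijective hl)).symm y
  have hx : (l : ℂ) • (x : X) - B x = y :=
    (LinearEquiv.ofBijective _ (hB.bijective hl)).apply_symm_apply y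
  exact (LinearPMap.mem_graph_iff _).2 ⟨x, rfl, (sub_eq_iff_eq_add.1 hx ▸ by simp [x])⟩

theorem resolvent_smul_sub {l : ℝ} (hl : 0 < l) {x z : X} (hxz : (x, z) ∈ B.graph) :
    hB.resolvent hl ((l : ℂ) • x - z) = x := by
  obtain ⟨w, rfl, rfl⟩ := (LinearPMap.mem_graph_iff _).1 hxz
  exact congrArg Subtype.val
    ((LinearEquiv.ofBijective _ (hB.bijective hl)).symm_apply_apply w)

theorem resolvent_map_mem_graph {l : ℝ} (hl : 0 < l) {x z : X} (hxz : (x, z) ∈ B.graph) :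
    (hB.resolvent hl x, hB.resolvent hl z) ∈ B.graph := by
  have h := hB.resolvent_smul_sub hl hxz
  rw [map_sub, map_smul, sub_eq_iff_eq_add, ← sub_eq_iff_eq_add'] at h
  rw [← h]
  exact hB.resolvent_mem_graph hl x

theorem resolvent_comm {l m : ℝ} (hl : 0 < l) (hm : 0 < m) (y : X) :
    hB.resolvent hl (hB.resolvent hm y) = hB.resolvent hm (hB.resolvent hl y) := by
  have h := hB.resolvent_smul_sub hl (hB.resolvent_map_mem_graph hm (hB.resolvent_mem_graph hl y))
  rwa [← map_smul, ← map_sub, sub_sub_cancel] at h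

theorem mul_norm_resolvent_le {l : ℝ} (hl : 0 < l) (y : X) : l * ‖hB.resolvent hl y‖ ≤ ‖y‖ := by
  simpa using hB.isDissipative.mul_norm_le_of_mem_graph hl (hB.resolvent_mem_graph hl y)

/-- The contractions `(n + 1) (n + 1 - B)⁻¹`, which converge strongly to the identity. -/
def regularizer (n : ℕ) : X →L[ℂ] X :=
  (((n + 1 : ℝ) : ℂ) • hB.resolvent n.cast_add_one_pos).mkContinuous 1 fun y => by
    rw [one_mul, LinearMap.smul_apply, norm_smul, Complex.norm_real,
      Real.norm_of_nonneg (by positivity)]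
    exact hB.mul_norm_resolvent_le n.cast_add_one_pos y

theorem regularizer_apply (n : ℕ) (y : X) :
    hB.regularizer n y = ((n + 1 : ℝ) : ℂ) • hB.resolvent n.cast_add_one_pos y := rfl

theorem norm_regularizer_le (n : ℕ) : ‖hB.regularizer n‖ ≤ 1 :=
  LinearMap.mkContinuous_norm_le _ zero_le_one _

theorem norm_regularizer_apply_le (n : ℕ) (y : X) : ‖hB.regularizer n y‖ ≤ ‖y‖ :=
  (hB.regularizer n).le_of_opNorm_le_of_le (hB.norm_regularizer_le n) le_rfl |>.trans_eq (one_mul _)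

theorem commute_regularizer (n m : ℕ) : Commute (hB.regularizer n) (hB.regularizer m) := by
  refine ContinuousLinearMap.ext fun y => ?_
  change hB.regularizer n (hB.regularizer m y) = hB.regularizer m (hB.regularizer n y)
  simp only [regularizer_apply, map_smul]
  rw [resolvent_comm, smul_comm]

/-- The Yosida approximation `(n + 1) B (n + 1 - B)⁻¹` of `B`. -/
def yosida (n : ℕ) : X →L[ℂ] X := (n + 1 : ℝ) • (hB.regularizer n - 1)

theorem yosida_apply (n : ℕ) {x z : X} (hxz : (x, z) ∈ B.graph) :
    hB.yosida n x = hB.regularizer n z := by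
  have h := hB.resolvent_smul_sub (Nat.cast_add_one_pos (α := ℝ) n) hxz
  rw [map_sub, map_smul, sub_eq_iff_eq_add] at h
  change (n + 1 : ℝ) • (hB.regularizer n x - x) = _
  rw [regularizer_apply, regularizer_apply, h, add_sub_cancel_left, ← Complex.coe_smul]

theorem commute_yosida (n m : ℕ) : Commute (hB.yosida n) (hB.yosida m) :=
  ((((hB.commute_regularizer n m).sub_left (Commute.one_left _)).sub_right
    (Commute.one_right _)).smul_right _).smul_left _

theorem norm_regularizer_sub_le (n : ℕ) {x z : X} (hxz : (x, z) ∈ B.graph) :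
    ‖hB.regularizer n x - x‖ ≤ ‖z‖ / (n + 1 : ℝ) := by
  have hn : (0 : ℝ) < n + 1 := n.cast_add_one_pos
  rw [le_div_iff₀' hn]
  calc (n + 1 : ℝ) * ‖hB.regularizer n x - x‖
      = ‖(n + 1 : ℝ) • (hB.regularizer n x - x)‖ := by rw [norm_smul, Real.norm_of_nonneg hn.le]
    _ = ‖hB.regularizer n z‖ := congrArg norm (hB.yosida_apply n hxz)
    _ ≤ ‖z‖ := hB.norm_regularizer_apply_le n z

theorem norm_exp_yosida_le (n : ℕ) {t : ℝ} (ht : 0 ≤ t) :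
    ‖NormedSpace.exp (t • hB.yosida n)‖ ≤ 1 := by
  rw [yosida, smul_smul]
  exact norm_exp_smul_sub_one_le ContinuousLinearMap.norm_id_le (hB.norm_regularizer_le n)
    (by positivity)

theorem lipschitzWith_exp_yosida {t : ℝ} (ht : 0 ≤ t) (n : ℕ) :
    LipschitzWith 1 fun x => NormedSpace.exp (t • hB.yosida n) x :=
  (ContinuousLinearMap.lipschitz _).weaken (hB.norm_exp_yosida_le n ht)

variable (hD : Dense (B.domain : Set X))
include hD

theorem tendsto_regularizer (x : X) : Tendsto (fun n => hB.regularizer n x) atTop (𝓝 x) := by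
  have hequi : Equicontinuous fun n => (hB.regularizer n : X → X) :=
    (LipschitzWith.uniformEquicontinuous _ 1 fun n =>
      (hB.regularizer n).lipschitz.weaken (hB.norm_regularizer_le n)).equicontinuous
  refine hD.induction (fun x hx => ?_) (hequi.isClosed_setOfPred_tendsto continuous_id) x
  refine tendsto_iff_norm_sub_tendsto_zero.2 ?_
  refine squeeze_zero (fun _ => norm_nonneg _)
    (fun n => hB.norm_regularizer_sub_le n (B.mem_graph ⟨x, hx⟩)) ?_
  simpa [div_eq_mul_inv] using
    (tendsto_one_div_add_atTop_nhds_zero_nat (𝕜 := ℝ)).const_mul ‖B ⟨x, hx⟩‖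

theorem tendsto_yosida {x z : X} (hxz : (x, z) ∈ B.graph) :
    Tendsto (fun n => hB.yosida n x) atTop (𝓝 z) := by
  simpa only [hB.yosida_apply _ hxz] using hB.tendsto_regularizer hD z

theorem cauchySeq_exp_yosida {t : ℝ} (ht : 0 ≤ t) (x : X) :
    CauchySeq fun n => NormedSpace.exp (t • hB.yosida n) x := by
  refine cauchySeq_apply_of_dense (hB.lipschitzWith_exp_yosida ht) hD (fun x hx => ?_) x
  have hcauchy := (hB.tendsto_yosida hD (B.mem_graph ⟨x, hx⟩)).cauchySeq
  rw [cauchySeq_iff_tendsto_dist_atTop_0] at hcauchy ⊢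
  refine squeeze_zero (fun _ => dist_nonneg) (fun p => ?_) (by simpa using hcauchy.const_mul t)
  rw [dist_eq_norm, dist_eq_norm]
  exact norm_exp_smul_sub_exp_smul_le (hB.commute_yosida _ _) (fun _ => hB.norm_exp_yosida_le _)
    (fun _ => hB.norm_exp_yosida_le _) ht x

theorem exists_tendsto_exp_yosida (t : ℝ≥0) : ∃ T : X →L[ℂ] X, ∀ x,
    Tendsto (fun n => NormedSpace.exp ((t : ℝ) • hB.yosida n) x) atTop (𝓝 (T x)) := by
  choose f hf using fun x =>
    cauchySeq_tendsto_of_complete (hB.cauchySeq_exp_yosida hD t.coe_nonneg x)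
  exact ⟨continuousLinearMapOfTendsto _ (tendsto_pi_nhds.2 hf), hf⟩

/-- The strong limit of the semigroups generated by the Yosida approximations of `B`. -/
def semigroupMap (t : ℝ≥0) : X →L[ℂ] X := (hB.exists_tendsto_exp_yosida hD t).choose

theorem tendsto_exp_yosida (t : ℝ≥0) (x : X) :
    Tendsto (fun n => NormedSpace.exp ((t : ℝ) • hB.yosida n) x) atTop
      (𝓝 (hB.semigroupMap hD t x)) :=
  (hB.exists_tendsto_exp_yosida hD t).choose_spec x

theorem tendsto_exp_yosida_apply (t : ℝ≥0) {x : ℕ → X} {a : X} (hx : Tendsto x atTop (𝓝 a)) :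
    Tendsto (fun n => NormedSpace.exp ((t : ℝ) • hB.yosida n) (x n)) atTop
      (𝓝 (hB.semigroupMap hD t a)) :=
  tendsto_apply_of_lipschitzWith (hB.lipschitzWith_exp_yosida t.coe_nonneg) hx
    (hB.tendsto_exp_yosida hD t a)

theorem norm_semigroupMap_le (t : ℝ≥0) : ‖hB.semigroupMap hD t‖ ≤ 1 :=
  ContinuousLinearMap.opNorm_le_bound _ zero_le_one fun x =>
    le_of_tendsto' (hB.tendsto_exp_yosida hD t x).norm fun n =>
      (NormedSpace.exp ((t : ℝ) • hB.yosida n)).le_of_opNorm_le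
        (hB.norm_exp_yosida_le n t.coe_nonneg) x

theorem semigroupMap_zero : hB.semigroupMap hD 0 = ContinuousLinearMap.id ℂ X :=
  ContinuousLinearMap.ext fun x => tendsto_nhds_unique (hB.tendsto_exp_yosida hD 0 x) (by simp)

theorem semigroupMap_add (s t : ℝ≥0) :
    hB.semigroupMap hD (s + t) = (hB.semigroupMap hD s).comp (hB.semigroupMap hD t) := by
  let := NormedAlgebra.restrictScalars ℚ ℝ (X →L[ℂ] X)
  refine ContinuousLinearMap.ext fun x =>
    tendsto_nhds_unique (hB.tendsto_exp_yosida hD (s + t) x) ?_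
  refine (hB.tendsto_exp_yosida_apply hD s (hB.tendsto_exp_yosida hD t x)).congr fun n => ?_
  rw [NNReal.coe_add, add_smul,
    NormedSpace.exp_add_of_commute (((Commute.refl _).smul_right _).smul_left _)]
  rfl

theorem lipschitzWith_semigroupMap {x z : X} (hxz : (x, z) ∈ B.graph) :
    LipschitzWith ‖z‖₊ fun t => hB.semigroupMap hD t x := by
  refine LipschitzWith.of_dist_le_mul fun s t => ?_
  refine le_of_tendsto' ((hB.tendsto_exp_yosida hD s x).dist (hB.tendsto_exp_yosida hD t x))
    fun n => ?_
  have hexp : ∀ r : ℝ≥0, ∀ u : ℝ, 0 ≤ u → ‖NormedSpace.exp (u • (r : ℝ) • hB.yosida n)‖ ≤ 1 :=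
    fun r u hu => by rw [smul_smul]; exact hB.norm_exp_yosida_le n (mul_nonneg hu r.coe_nonneg)
  have hle := norm_exp_smul_sub_exp_smul_le
    (((Commute.refl (hB.yosida n)).smul_right (t : ℝ)).smul_left (s : ℝ)) (hexp s) (hexp t)
    zero_le_one x
  simp only [one_smul, one_mul, smul_apply, ← sub_smul, norm_smul] at hle
  rw [dist_eq_norm, mul_comm, NNReal.dist_eq, coe_nnnorm]
  refine hle.trans (mul_le_mul_of_nonneg_left ?_ (abs_nonneg _))
  rw [hB.yosida_apply n hxz]
  exact hB.norm_regularizer_apply_le n z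

theorem continuous_semigroupMap (x : X) : Continuous fun t => hB.semigroupMap hD t x := by
  have hequi : Equicontinuous fun t => (hB.semigroupMap hD t : X → X) :=
    (LipschitzWith.uniformEquicontinuous _ 1 fun t =>
      (hB.semigroupMap hD t).lipschitz.weaken (hB.norm_semigroupMap_le hD t)).equicontinuous
  refine continuous_iff_continuousAt.2 fun t => ?_
  exact hD.induction
    (fun x hx => (hB.lipschitzWith_semigroupMap hD (B.mem_graph ⟨x, hx⟩)).continuous.tendsto t)
    (hequi.isClosed_setOfPred_tendsto (hB.semigroupMap hD t).continuous) x

/-- The contraction semigroup generated by a densely defined maximal dissipative operator. -/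
def semigroup : ContractionSemigroup X where
  T := hB.semigroupMap hD
  map_zero := hB.semigroupMap_zero hD
  map_add := hB.semigroupMap_add hD
  strongly_continuous := hB.continuous_semigroupMap hD
  contraction := hB.norm_semigroupMap_le hD

theorem semigroup_orbit_sub {x z : X} (hxz : (x, z) ∈ B.graph) {t : ℝ} (ht : 0 ≤ t) :
    (hB.semigroup hD).orbit x t - x = ∫ s in 0..t, (hB.semigroup hD).orbit z s := by
  have hcont : ∀ n, Continuous fun s : ℝ => NormedSpace.exp (s • hB.yosida n) (hB.yosida n x) :=
    fun n => continuous_iff_continuousAt.2 fun s =>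
      (hasDerivAt_exp_smul_apply (hB.yosida n) (hB.yosida n x) s).continuousAt
  have happrox : ∀ n, NormedSpace.exp (t • hB.yosida n) x - x
      = ∫ s in 0..t, NormedSpace.exp (s • hB.yosida n) (hB.yosida n x) := fun n => by
    rw [intervalIntegral.integral_eq_sub_of_hasDerivAt
      (fun s _ => hasDerivAt_exp_smul_apply (hB.yosida n) x s) ((hcont n).intervalIntegrable 0 t)]
    simp
  have hlim := (hB.tendsto_exp_yosida hD t.toNNReal x).sub_const x
  rw [Real.coe_toNNReal t ht] at hlim
  simp only [happrox] at hlim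
  refine tendsto_nhds_unique hlim ?_
  refine intervalIntegral.tendsto_integral_filter_of_dominated_convergence (fun _ => ‖z‖)
    (.of_forall fun n => (hcont n).aestronglyMeasurable) (.of_forall fun n => .of_forall ?_)
    intervalIntegrable_const (.of_forall ?_)
  · intro s hs
    rw [Set.uIoc_of_le ht] at hs
    rw [hB.yosida_apply n hxz]
    exact ((NormedSpace.exp (s • hB.yosida n)).le_of_opNorm_le
      (hB.norm_exp_yosida_le n hs.1.le) _).trans
      ((one_mul _).trans_le (hB.norm_regularizer_apply_le n z))
  · intro s hs
    rw [Set.uIoc_of_le ht] at hs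
    have h := hB.tendsto_exp_yosida_apply hD s.toNNReal (hB.tendsto_yosida hD hxz)
    rwa [Real.coe_toNNReal s hs.1.le] at h

/-- The **Lumer–Phillips theorem**. -/
theorem generatesContractionSemigroup : GeneratesContractionSemigroup B := by
  have hgraph : ∀ {x z : X}, (x, z) ∈ B.graph → Tendsto
      (fun h : ℝ≥0 => ((h : ℝ)⁻¹ : ℂ) • ((hB.semigroup hD).T h x - x)) (𝓝[>] 0) (𝓝 z) :=
    fun hxz => (hB.semigroup hD).tendsto_difference_quotient_iff.2 <|
      (hB.semigroup hD).hasDerivWithinAt_orbit_zero_iff.2 fun _ => hB.semigroup_orbit_sub hD hxz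
  refine ⟨hB.semigroup hD, fun x y => ⟨hgraph, fun hxy => ?_⟩⟩
  obtain ⟨z, hz⟩ := hB.surjective_one_sub (x - y)
  -- The generator maps `x - z` to itself, which dissipativity allows for `x = z` only.
  have hBz : y - B z = x - z := by
    rw [sub_eq_sub_iff_add_eq_add] at hz ⊢
    rwa [add_comm]
  have hfix : Tendsto (fun h : ℝ≥0 => ((h : ℝ)⁻¹ : ℂ) • ((hB.semigroup hD).T h (x - z) - (x - z)))
      (𝓝[>] 0) (𝓝 (x - z)) := by
    refine (hBz ▸ hxy.sub (hgraph (B.mem_graph z))).congr fun h => ?_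
    rw [← smul_sub, sub_sub_sub_comm, ← map_sub]
  have hxz : x - z = 0 := by
    simpa using (hB.semigroup hD).mul_norm_le_norm_smul_sub hfix 1
  rw [hxz, sub_eq_zero] at hBz
  exact (LinearPMap.mem_graph_iff _).2 ⟨z, (sub_eq_zero.1 hxz).symm, hBz.symm⟩

end IsMaxDissipative

end Dissipative

/-! ## Coercive systems -/

section Coercive

variable {𝕜 E F : Type*} [RCLike 𝕜] [NormedAddCommGroup E] [InnerProductSpace 𝕜 E]
  [CompleteSpace E] [NormedAddCommGroup F] [InnerProductSpace 𝕜 F] [CompleteSpace F]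

theorem isUnit_of_coercive {P : E →L[𝕜] E} {a : ℝ} (ha : 0 < a)
    (hP : ∀ x, a * ‖x‖ ^ 2 ≤ RCLike.re (inner 𝕜 (P x) x)) : IsUnit P :=
  P.isUnit_of_forall_le_norm_inner_map (c := ⟨a, ha.le⟩) ha fun x =>
    (mul_comm _ _).trans_le ((hP x).trans (RCLike.re_le_norm _))

theorem mul_sq_norm_le_re_inner_smul_add_adjoint (J : E →L[𝕜] F) (a : ℝ) (x : E) :
    a * ‖x‖ ^ 2 ≤ RCLike.re (inner 𝕜 (((a : 𝕜) • 1 + J.adjoint.comp J : E →L[𝕜] E) x) x) := by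
  change _ ≤ RCLike.re (inner 𝕜 ((a : 𝕜) • x + J.adjoint (J x)) x)
  rw [inner_add_left, inner_smul_left, ContinuousLinearMap.adjoint_inner_left, map_add,
    RCLike.conj_ofReal, RCLike.re_ofReal_mul, inner_self_eq_norm_sq, inner_self_eq_norm_sq]
  exact le_add_of_nonneg_right (sq_nonneg _)

theorem exists_solution_of_coercive {P : E →L[𝕜] E} {Q : F →L[𝕜] F} (M : F →L[𝕜] E) {a b : ℝ}
    (ha : 0 < a) (hb : 0 < b) (hP : ∀ x, a * ‖x‖ ^ 2 ≤ RCLike.re (inner 𝕜 (P x) x))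
    (hQ : ∀ y, b * ‖y‖ ^ 2 ≤ RCLike.re (inner 𝕜 (Q y) y)) (f : E) (g : F) :
    ∃ x y, P x + M y = f ∧ Q y - M.adjoint x = g := by
  obtain ⟨R, hR⟩ := (isUnit_of_coercive hb hQ).exists_right_inv
  have hQR : ∀ y, Q (R y) = y := fun y => congrArg (fun T : F →L[𝕜] F => T y) hR
  -- The Schur complement of `Q`.
  have hSchur : ∀ x,
      a * ‖x‖ ^ 2 ≤ RCLike.re (inner 𝕜 ((P + M.comp (R.comp M.adjoint)) x) x) := fun x => by
    have hR_nonneg : 0 ≤ RCLike.re (inner 𝕜 (R (M.adjoint x)) (M.adjoint x)) := by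
      have h := hQ (R (M.adjoint x))
      rw [hQR, inner_re_symm] at h
      exact le_trans (by positivity) h
    change _ ≤ RCLike.re (inner 𝕜 (P x + M (R (M.adjoint x))) x)
    rw [inner_add_left, map_add, ← ContinuousLinearMap.adjoint_inner_right M]
    linarith [hP x]
  obtain ⟨x, hx⟩ := (ContinuousLinearMap.isUnit_iff_bijective.1 (isUnit_of_coercive ha hSchur)).2
    (f - M (R g))
  change P x + M (R (M.adjoint x)) = _ at hx
  refine ⟨x, R (g + M.adjoint x), ?_, ?_⟩
  · rw [map_add, map_add, add_left_comm, hx, add_sub_cancel]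
  · rw [hQR, add_sub_cancel_right]

end Coercive

/-! ## The spaces `H_{1/2}` and `H^τ` -/

namespace PosSelfAdjoint

variable {H : Type*} [NormedAddCommGroup H] [InnerProductSpace ℂ H] [CompleteSpace H]
  (P : PosSelfAdjoint H)

theorem inner_opToHalf (x : P.op.domain) (u : P.Half) :
    inner ℂ (P.opToHalf x) u = inner ℂ (P.op x) (Half.incl P u) := by
  have hroot : Half.root P (P.opToHalf x) = P.invSqrt (P.op x) := by
    refine P.invSqrt_injective ?_
    rw [Half.invSqrt_root, invSqrt_invSqrt, inv_op]
    rfl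
  have hsymm := ContinuousLinearMap.isSelfAdjoint_iff_isSymmetric.1
    (IsSelfAdjoint.of_nonneg (CFC.sqrt_nonneg P.inv))
  rw [Half.inner_def, hroot, ← Half.invSqrt_root]
  exact hsymm _ _

/-- The inverse `A⁻¹` as a bounded operator `H → H_{1/2}`, obtained as the adjoint of the inclusion
`H_{1/2} ⊆ H`; see `invHalf_eq_opToHalf`. -/
def invHalf : H →L[ℂ] P.Half := (Half.inclL P).adjoint

theorem inner_invHalf_right (u : P.Half) (y : H) :
    inner ℂ u (P.invHalf y) = inner ℂ (Half.incl P u) y :=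
  ContinuousLinearMap.adjoint_inner_right _ _ _

theorem inner_invHalf_left (y : H) (u : P.Half) :
    inner ℂ (P.invHalf y) u = inner ℂ y (Half.incl P u) :=
  ContinuousLinearMap.adjoint_inner_left _ _ _

theorem invHalf_op (x : P.op.domain) : P.invHalf (P.op x) = P.opToHalf x :=
  ext_inner_right ℂ fun u => by rw [inner_invHalf_left, inner_opToHalf]

theorem invHalf_eq_opToHalf (y : H) : P.invHalf y = P.opToHalf ⟨P.inv y, P.inv_mem y⟩ := by
  rw [← invHalf_op, op_inv]

theorem denseRange_incl : DenseRange (Half.incl P) :=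
  P.selfAdjoint.dense_domain.mono fun x hx => ⟨P.opToHalf ⟨x, hx⟩, rfl⟩

theorem denseRange_opToHalf : DenseRange P.opToHalf := by
  have hker : P.invHalf.rangeᗮ = ⊥ := by
    rw [ContinuousLinearMap.orthogonal_range, invHalf, ContinuousLinearMap.adjoint_adjoint]
    exact LinearMap.ker_eq_bot.2 Subtype.val_injective
  have hdense : DenseRange P.invHalf :=
    Submodule.dense_iff_topologicalClosure_eq_top.2
      (Submodule.topologicalClosure_eq_top_iff.2 hker)
  exact hdense.mono (Set.range_subset_iff.2 fun y => ⟨_, (P.invHalf_eq_opToHalf y).symm⟩)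

theorem pivot_injective : Function.Injective P.pivot := fun _ _ hxy =>
  P.denseRange_incl.eq_of_inner_right ℂ (DFunLike.congr_fun hxy)

end PosSelfAdjoint

namespace Scaled

variable (τ : {τ : ℝ // 0 < τ}) (H : Type*) [NormedAddCommGroup H] [InnerProductSpace ℂ H]

theorem norm_eq (u : Scaled τ H) : ‖u‖ = √τ.1 * ‖toBase τ H u‖ := by
  rw [@norm_eq_sqrt_re_inner ℂ, inner_def, RCLike.re_to_complex, Complex.re_ofReal_mul,
    Real.sqrt_mul τ.2.le, ← RCLike.re_to_complex, ← norm_eq_sqrt_re_inner]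

/-- Multiplication by `√τ`, as an isometry `H^τ ≃ H`. -/
def sqrtSMulEquiv : Scaled τ H ≃ₗᵢ[ℂ] H where
  toLinearEquiv := (toBase τ H).trans <| LinearEquiv.smulOfNeZero ℂ H ((√τ.1 : ℝ) : ℂ) <|
    Complex.ofReal_ne_zero.2 (Real.sqrt_pos.2 τ.2).ne'
  norm_map' u := by
    rw [norm_eq]
    change ‖((√τ.1 : ℝ) : ℂ) • toBase τ H u‖ = _
    rw [norm_smul, Complex.norm_real, Real.norm_of_nonneg (Real.sqrt_nonneg _)]

instance [CompleteSpace H] : CompleteSpace (Scaled τ H) :=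
  (sqrtSMulEquiv τ H).toIsometryEquiv.completeSpace

theorem continuous_toBase_symm : Continuous (toBase τ H).symm :=
  (LipschitzWith.of_dist_le_mul (K := ⟨√τ.1, Real.sqrt_nonneg _⟩) fun u v => by
    rw [dist_eq_norm, dist_eq_norm, ← map_sub, norm_eq, LinearEquiv.apply_symm_apply]
    rfl).continuous

end Scaled

/-! ## Dissipativity and resolvent equations -/

open PosSelfAdjoint

namespace ThermoElastic

variable {H₁ H₂ : Type*} [NormedAddCommGroup H₁] [InnerProductSpace ℂ H₁] [CompleteSpace H₁]
  [NormedAddCommGroup H₂] [InnerProductSpace ℂ H₂] [CompleteSpace H₂] (S : ThermoElastic H₁ H₂)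

theorem inner_A₂star (v : S.A.Half) (w : H₁) : inner ℂ (S.A₂star v) w = S.A₂ w v :=
  inner_dualAdjoint S.A₂ v w

theorem inner_Cstar_incl (u : S.A₁.Half) (v : S.A.Half) :
    inner ℂ (S.Cstar u) (Half.incl S.A v) = inner ℂ (Half.incl S.A₁ u) (S.Chalf v) :=
  (inner_dualAdjoint S.C u _).trans (by rw [S.Chalf_eq, pivot_apply])

theorem A₂_eq_pivot_iff {w : H₁} {f : H₂} :
    S.A₂ w = S.A.pivot f ↔ S.A₂star.adjoint w = S.A.invHalf f := by
  have hA₂ : ∀ v, S.A₂ w v = inner ℂ v (S.A₂star.adjoint w) := fun v => by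
    rw [ContinuousLinearMap.adjoint_inner_right, inner_A₂star]
  have hpivot : ∀ v, S.A.pivot f v = inner ℂ v (S.A.invHalf f) := fun v => by
    rw [pivot_apply, inner_invHalf_right]
  rw [DFunLike.ext_iff, ext_iff_inner_left ℂ]
  simp only [hA₂, hpivot]

theorem adjoint_A₂star_incl (w : S.A₁.Half) :
    S.A₂star.adjoint (Half.incl S.A₁ w) = S.A.invHalf (S.A₂half w) :=
  S.A₂_eq_pivot_iff.1 (S.A₂half_eq w)

theorem adjoint_A₂star_A₂star (v : S.A.Half) : S.A₂star.adjoint (S.A₂star v) = v := by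
  refine congrFun (S.A.denseRange_opToHalf.equalizer
    (S.A₂star.adjoint.continuous.comp S.A₂star.continuous) continuous_id (funext fun x => ?_)) v
  exact (S.A₂_eq_pivot_iff.1 (S.A_eq x)).trans (S.A.invHalf_op x)

theorem A₂star_invHalf_mem (f : H₂) : S.A₂star (S.A.invHalf f) ∈ S.A₁.sqrt.domain := by
  rw [invHalf_eq_opToHalf]
  exact S.A₂star_mem _

theorem mem_closure_of_A₂_eq_pivot {w : H₁} {f : H₂} (hw : S.A₂ w = S.A.pivot f) :
    w ∈ closure (Half.incl S.A₁ '' {u | S.A₂half u = f}) := by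
  -- `A₂*` is an isometric embedding with left inverse `A₂`, so `π` is the orthogonal projection
  -- onto `{z | A₂ z = f}`.
  let π : H₁ → H₁ := fun z => z - S.A₂star (S.A₂star.adjoint z) + S.A₂star (S.A.invHalf f)
  have hπw : π w = w := by simp only [π, S.A₂_eq_pivot_iff.1 hw, sub_add_cancel]
  have hπ : Set.MapsTo π (Set.range (Half.incl S.A₁)) (Half.incl S.A₁ '' {u | S.A₂half u = f}) := by
    rintro _ ⟨u, rfl⟩
    have hmem : π (Half.incl S.A₁ u) ∈ S.A₁.sqrt.domain := by
      simp only [π, adjoint_A₂star_incl]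
      exact add_mem (sub_mem u.2 (S.A₂star_invHalf_mem _)) (S.A₂star_invHalf_mem _)
    refine ⟨Half.ofMem _ hmem, S.A.pivot_injective ?_, rfl⟩
    rw [← S.A₂half_eq, A₂_eq_pivot_iff, Half.incl_ofMem, map_add, map_sub,
      adjoint_A₂star_A₂star, adjoint_A₂star_A₂star, sub_self, zero_add]
  rw [← hπw]
  exact map_mem_closure (by fun_prop) (S.A₁.denseRange_incl w) hπ

theorem invHalf_Cstar (u : S.A₁.Half) :
    S.A.invHalf (S.Cstar u) = S.Chalf.adjoint (Half.incl S.A₁ u) :=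
  ext_inner_right ℂ fun v => by
    rw [inner_invHalf_left, inner_Cstar_incl, ContinuousLinearMap.adjoint_inner_left]

theorem exists_resolvent_solution {k : ℝ} (hk : 0 < k) (f₁ : S.A₁.Half) (f₂ : H₁) (g : S.A.Half) :
    ∃ (u₁ : S.A₁.op.domain) (u₂ : S.A₁.Half) (v : S.A.Half),
      S.A₁.opToHalf u₁ - u₂ = f₁ ∧
      Half.incl S.A₁ u₂ + S.A₁.op u₁ + S.Chalf v = f₂ ∧
      S.A.invHalf (Half.incl S.A v - S.Cstar u₂) + (k : ℂ) • v = g := by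
  -- Eliminating `u₁` leaves a system for `(u₂, v)` that is skew apart from its coercive diagonal.
  obtain ⟨u₂, v, hu₂, hv⟩ := exists_solution_of_coercive (S.A₁.invHalf.comp S.Chalf) one_pos hk
    (mul_sq_norm_le_re_inner_smul_add_adjoint (Half.inclL S.A₁) 1)
    (mul_sq_norm_le_re_inner_smul_add_adjoint (Half.inclL S.A) k) (S.A₁.invHalf f₂ - f₁) g
  have hadj : (S.A₁.invHalf.comp S.Chalf).adjoint u₂ = S.A.invHalf (S.Cstar u₂) := by
    rw [invHalf_Cstar, ContinuousLinearMap.adjoint_comp, invHalf,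
      ContinuousLinearMap.adjoint_adjoint]
    rfl
  change ((1 : ℝ) : ℂ) • u₂ + S.A₁.invHalf (Half.incl S.A₁ u₂) + S.A₁.invHalf (S.Chalf v) =
    S.A₁.invHalf f₂ - f₁ at hu₂
  change (k : ℂ) • v + S.A.invHalf (Half.incl S.A v) - _ = g at hv
  rw [Complex.ofReal_one, one_smul] at hu₂
  rw [hadj] at hv
  refine ⟨⟨S.A₁.inv (f₂ - Half.incl S.A₁ u₂ - S.Chalf v), S.A₁.inv_mem _⟩, u₂, v, ?_, ?_, ?_⟩
  · rw [← invHalf_eq_opToHalf, map_sub, map_sub, eq_add_of_sub_eq hu₂.symm]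
    abel
  · rw [op_inv]
    abel
  · rw [map_sub, ← hv]
    abel

theorem re_inner_coupling_eq_zero (u₁ : S.A₁.op.domain) (u₂ : S.A₁.Half) (v : S.A.Half) :
    (inner ℂ u₂ (S.A₁.opToHalf u₁) + inner ℂ (-S.A₁.op u₁ - S.Chalf v) (Half.incl S.A₁ u₂)
      + inner ℂ (S.Cstar u₂) (Half.incl S.A v)).re = 0 := by
  rw [← inner_conj_symm u₂, inner_opToHalf, inner_Cstar_incl,
    ← inner_conj_symm (Half.incl S.A₁ u₂), inner_sub_left, inner_neg_left]
  simp only [Complex.add_re, Complex.sub_re, Complex.neg_re, Complex.conj_re]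
  ring

theorem re_inner_op₀ (W : S.op₀.domain) :
    (inner ℂ (S.op₀ W) (W : S.Space₀)).re =
      -(inner ℂ (S.A.op (S.comp₃ W)) (S.comp₃ W : H₂)).re := by
  have hcoupling := S.re_inner_coupling_eq_zero (S.comp₁ W) (S.comp₂ W) (S.A.opToHalf (S.comp₃ W))
  change (inner ℂ (S.vec₀ (S.comp₂ W)
      (-S.A₁.op (S.comp₁ W) - S.Chalf (S.A.opToHalf (S.comp₃ W)))
      (S.Cstar (S.comp₂ W) - S.A.op (S.comp₃ W)))
    (S.vec₀ (S.A₁.opToHalf (S.comp₁ W)) (Half.incl S.A₁ (S.comp₂ W)) (S.comp₃ W))).re = _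
  rw [inner_vec₀, ← Half.inner_def, inner_sub_left (S.Cstar _), ← add_sub_assoc, Complex.sub_re]
  exact (congrArg (· - _) hcoupling).trans (zero_sub _)

theorem isDissipative_op₀ : IsDissipative S.op₀ := by
  obtain ⟨m, hm, hA⟩ := S.A.pos
  refine isDissipative_of_re_inner_nonpos fun W => ?_
  rw [re_inner_op₀, neg_nonpos]
  exact le_trans (by positivity) (hA (S.comp₃ W))

theorem mem_graph_op₀ (u₁ : S.A₁.op.domain) (u₂ : S.A₁.Half) (v : S.A.op.domain) :
    (S.vec₀ (S.A₁.opToHalf u₁) (Half.incl S.A₁ u₂) v,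
      S.vec₀ u₂ (-S.A₁.op u₁ - S.Chalf (S.A.opToHalf v)) (S.Cstar u₂ - S.A.op v))
        ∈ S.op₀.graph :=
  (LinearPMap.mem_graph_iff _).2
    ⟨⟨S.vec₀ (S.A₁.opToHalf u₁) (Half.incl S.A₁ u₂) v, u₁.2, u₂.2, v.2⟩, rfl, rfl⟩

theorem dense_op₀_domain : Dense (S.op₀.domain : Set S.Space₀) := by
  have hcont : Continuous fun p : (S.A₁.Half × H₁) × H₂ => S.vec₀ p.1.1 p.1.2 p.2 :=
    (WithLp.prod_continuous_toLp 2 _ _).comp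
      (((WithLp.prod_continuous_toLp 2 _ _).comp continuous_fst).prodMk continuous_snd)
  have hsurj : Function.Surjective fun p : (S.A₁.Half × H₁) × H₂ => S.vec₀ p.1.1 p.1.2 p.2 :=
    fun W => ⟨((W.fst.fst, W.fst.snd), W.snd), rfl⟩
  have hop : DenseRange (Subtype.val : S.A.op.domain → H₂) :=
    S.A.selfAdjoint.dense_domain.denseRange_val
  refine (hsurj.denseRange.comp
    ((S.A₁.denseRange_opToHalf.prodMap S.A₁.denseRange_incl).prodMap hop) hcont).mono ?_
  rintro _ ⟨⟨⟨u₁, u₂⟩, v⟩, rfl⟩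
  exact ⟨u₁.2, u₂.2, v.2⟩

theorem isMaxDissipative_op₀ : IsMaxDissipative S.op₀ :=
  S.isDissipative_op₀.isMaxDissipative fun F => by
    obtain ⟨u₁, u₂, v, h₁, h₂, h₃⟩ :=
      S.exists_resolvent_solution one_pos F.fst.fst F.fst.snd (S.A.invHalf F.snd)
    let y : H₂ := F.snd - Half.incl S.A v + S.Cstar u₂
    have hv : v = S.A.opToHalf ⟨S.A.inv y, S.A.inv_mem y⟩ := by
      rw [Complex.ofReal_one, one_smul] at h₃
      rw [← invHalf_eq_opToHalf, map_add, map_sub, ← h₃, map_sub]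
      abel
    have hAv : Half.incl S.A v - (S.Cstar u₂ - y) = F.snd := by
      simp only [y]
      abel
    have hCv : Half.incl S.A₁ u₂ - (-S.A₁.op u₁ - S.Chalf v) = F.fst.snd := by
      rw [← h₂]
      abel
    refine ⟨_, S.mem_graph_op₀ u₁ u₂ ⟨S.A.inv y, S.A.inv_mem y⟩, ?_⟩
    rw [op_inv, ← hv]
    change S.vec₀ (S.A₁.opToHalf u₁ - u₂) (Half.incl S.A₁ u₂ - (-S.A₁.op u₁ - S.Chalf v))
      (Half.incl S.A (S.A.opToHalf ⟨S.A.inv y, S.A.inv_mem y⟩) - (S.Cstar u₂ - y)) = F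
    rw [← hv, h₁, hCv, hAv]
    rfl

section Delayed

variable (τ : {τ : ℝ // 0 < τ})

/-- The element `(u₁, u₂, v, w)` of `ℋ`, for `u₁ ∈ H_{1,1}`, `u₂ ∈ H_{1,1/2}`, `v ∈ H_{2,1/2}` and
`w ∈ H₁`. -/
def state (u₁ : S.A₁.op.domain) (u₂ : S.A₁.Half) (v : S.A.Half) (w : H₁) : S.Space τ :=
  S.vec τ (S.A₁.opToHalf u₁) (Half.incl S.A₁ u₂) (Half.incl S.A v) w

/-- The value of `𝒜_d` at `S.state τ u₁ u₂ v w`, with `f` in place of `A₂ w`; this makes sense also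
when `w` lies only in the natural domain of `A₂`. -/
def velocity (u₁ : S.A₁.op.domain) (u₂ : S.A₁.Half) (v : S.A.Half) (w : H₁) (f : H₂) :
    S.Space τ :=
  S.vec τ u₂ (-S.A₁.op u₁ - S.Chalf v) (S.Cstar u₂ - f)
    ((τ.1 : ℂ)⁻¹ • S.A₂star v - (τ.1 : ℂ)⁻¹ • w)

theorem re_inner_velocity_state (u₁ : S.A₁.op.domain) (u₂ : S.A₁.Half) (v : S.A.Half) {w : H₁}
    {f : H₂} (hw : S.A₂ w = S.A.pivot f) :
    (inner ℂ (S.velocity τ u₁ u₂ v w f) (S.state τ u₁ u₂ v w)).re = -‖w‖ ^ 2 := by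
  have hτ : (τ.1 : ℂ) ≠ 0 := Complex.ofReal_ne_zero.2 τ.2.ne'
  have hcoupling := S.re_inner_coupling_eq_zero u₁ u₂ v
  have hA₂ : (inner ℂ (S.A₂star v) w).re = (inner ℂ f (Half.incl S.A v)).re := by
    rw [inner_A₂star, hw, pivot_apply, ← inner_conj_symm, Complex.conj_re]
  have hnorm : (inner ℂ w w).re = ‖w‖ ^ 2 := inner_self_eq_norm_sq (𝕜 := ℂ) w
  rw [velocity, state, inner_vec, ← Half.inner_def, ← smul_sub, inner_smul_left, map_inv₀,
    Complex.conj_ofReal, mul_inv_cancel_left₀ hτ, inner_sub_left (S.A₂star v),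
    inner_sub_left (S.Cstar _)]
  simp only [Complex.add_re, Complex.sub_re] at hcoupling ⊢
  linarith

theorem isDissipative_opD : IsDissipative (S.opD τ) :=
  isDissipative_of_re_inner_nonpos fun W =>
    (S.re_inner_velocity_state τ (S.compD₁ τ W) (S.compD₂ τ W) (S.compD₃ τ W)
      (S.A₂half_eq (S.compD₄ τ W))).trans_le (neg_nonpos.2 (sq_nonneg _))

theorem mem_graph_opD (u₁ : S.A₁.op.domain) (u₂ : S.A₁.Half) (v : S.A.Half) (w : S.A₁.Half) :
    (S.state τ u₁ u₂ v (Half.incl S.A₁ w), S.velocity τ u₁ u₂ v (Half.incl S.A₁ w) (S.A₂half w))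
      ∈ (S.opD τ).graph :=
  (LinearPMap.mem_graph_iff _).2
    ⟨⟨S.state τ u₁ u₂ v (Half.incl S.A₁ w), u₁.2, u₂.2, v.2, w.2⟩, rfl, rfl⟩

theorem continuous_vec :
    Continuous fun p : (S.A₁.Half × H₁) × H₂ × H₁ => S.vec τ p.1.1 p.1.2 p.2.1 p.2.2 :=
  (WithLp.prod_continuous_toLp 2 _ _).comp <|
    ((WithLp.prod_continuous_toLp 2 _ _).comp continuous_fst).prodMk <|
      (WithLp.prod_continuous_toLp 2 _ _).comp <| continuous_snd.fst.prodMk <|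
        (Scaled.continuous_toBase_symm τ H₁).comp continuous_snd.snd

theorem dense_opD_domain : Dense ((S.opD τ).domain : Set (S.Space τ)) := by
  have hsurj : Function.Surjective
      fun p : (S.A₁.Half × H₁) × H₂ × H₁ => S.vec τ p.1.1 p.1.2 p.2.1 p.2.2 :=
    fun W => ⟨((W.fst.fst, W.fst.snd), W.snd.fst, Scaled.toBase τ H₁ W.snd.snd), rfl⟩
  refine (hsurj.denseRange.comp ((S.A₁.denseRange_opToHalf.prodMap S.A₁.denseRange_incl).prodMap
    (S.A.denseRange_incl.prodMap S.A₁.denseRange_incl)) (S.continuous_vec τ)).mono ?_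
  rintro _ ⟨⟨⟨u₁, u₂⟩, v, w⟩, rfl⟩
  exact ⟨u₁.2, u₂.2, v.2, w.2⟩

theorem isClosable_opD : (S.opD τ).IsClosable :=
  (S.isDissipative_opD τ).isClosable (S.dense_opD_domain τ)

theorem dense_closure_opD_domain : Dense ((S.opD τ).closure.domain : Set (S.Space τ)) :=
  (S.dense_opD_domain τ).mono (S.opD τ).le_closure.1

theorem mem_graph_closure_opD (u₁ : S.A₁.op.domain) (u₂ : S.A₁.Half) (v : S.A.Half) {w : H₁}
    {f : H₂} (hw : S.A₂ w = S.A.pivot f) :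
    (S.state τ u₁ u₂ v w, S.velocity τ u₁ u₂ v w f) ∈ (S.opD τ).closure.graph := by
  have hcont : Continuous fun z => (S.state τ u₁ u₂ v z, S.velocity τ u₁ u₂ v z f) :=
    ((S.continuous_vec τ).comp (by fun_prop : Continuous fun z =>
        ((S.A₁.opToHalf u₁, Half.incl S.A₁ u₂), Half.incl S.A v, z))).prodMk
      ((S.continuous_vec τ).comp (by fun_prop : Continuous fun z =>
        ((u₂, -S.A₁.op u₁ - S.Chalf v), S.Cstar u₂ - f,
          (τ.1 : ℂ)⁻¹ • S.A₂star v - (τ.1 : ℂ)⁻¹ • z)))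
  rw [← (S.isClosable_opD τ).graph_closure_eq_closure_graph]
  refine map_mem_closure (t := (S.opD τ).graph) hcont (S.mem_closure_of_A₂_eq_pivot hw) ?_
  rintro _ ⟨u, rfl, rfl⟩
  exact S.mem_graph_opD τ u₁ u₂ v u

theorem exists_state_sub_velocity_eq (F : S.Space τ) :
    ∃ (u₁ : S.A₁.op.domain) (u₂ : S.A₁.Half) (v : S.A.Half) (w : H₁) (f : H₂),
      S.A₂ w = S.A.pivot f ∧ S.state τ u₁ u₂ v w - S.velocity τ u₁ u₂ v w f = F := by
  have hτ : (τ.1 : ℂ) ≠ 0 := Complex.ofReal_ne_zero.2 τ.2.ne'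
  have hτ' : (1 + τ.1 : ℂ) ≠ 0 := by exact_mod_cast (add_pos one_pos τ.2).ne'
  let k : ℂ := (1 + τ.1 : ℂ)⁻¹
  let f₄ : H₁ := Scaled.toBase τ H₁ F.snd.snd
  obtain ⟨u₁, u₂, v, h₁, h₂, h₃⟩ := S.exists_resolvent_solution
    (inv_pos.2 (add_pos one_pos τ.2)) F.fst.fst F.fst.snd
    (S.A.invHalf F.snd.fst - (k * τ.1) • S.A₂star.adjoint f₄)
  -- The last component of the resolvent equation determines `w`, the third one `f`.
  let w : H₁ := k • ((τ.1 : ℂ) • f₄ + S.A₂star v)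
  let f : H₂ := F.snd.fst - Half.incl S.A v + S.Cstar u₂
  have hCv : Half.incl S.A₁ u₂ - (-S.A₁.op u₁ - S.Chalf v) = F.fst.snd := by
    rw [← h₂]
    abel
  have hf : Half.incl S.A v - (S.Cstar u₂ - f) = F.snd.fst := by
    simp only [f]
    abel
  have hw : w - ((τ.1 : ℂ)⁻¹ • S.A₂star v - (τ.1 : ℂ)⁻¹ • w) = f₄ := by
    simp only [w, k]
    match_scalars <;> field_simp <;> ring
  refine ⟨u₁, u₂, v, w, f, ?_, ?_⟩
  · rw [A₂_eq_pivot_iff]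
    simp only [w, f, map_smul, map_add, map_sub, adjoint_A₂star_A₂star]
    push_cast [map_sub] at h₃
    linear_combination (norm := module) h₃
  · change S.vec τ (S.A₁.opToHalf u₁ - u₂) (Half.incl S.A₁ u₂ - (-S.A₁.op u₁ - S.Chalf v))
      (Half.incl S.A v - (S.Cstar u₂ - f))
      (w - ((τ.1 : ℂ)⁻¹ • S.A₂star v - (τ.1 : ℂ)⁻¹ • w)) = F
    rw [h₁, hCv, hf, hw]
    rfl

theorem isMaxDissipative_closure_opD : IsMaxDissipative (S.opD τ).closure :=
  ((S.isDissipative_opD τ).closure (S.isClosable_opD τ)).isMaxDissipative fun F => by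
    obtain ⟨u₁, u₂, v, w, f, hw, hF⟩ := S.exists_state_sub_velocity_eq τ F
    exact ⟨_, S.mem_graph_closure_opD τ u₁ u₂ v hw, hF⟩

variable {τ}

theorem isMaxDissipative_opD (hS : S.A₂DomainEqHalf) : IsMaxDissipative (S.opD τ) :=
  (S.isDissipative_opD τ).isMaxDissipative fun F => by
    obtain ⟨u₁, u₂, v, w, f, hw, hF⟩ := S.exists_state_sub_velocity_eq τ F
    let w' : S.A₁.Half := Half.ofMem w (hS w ⟨f, hw⟩)
    have hf : S.A₂half w' = f := S.A.pivot_injective ((S.A₂half_eq w').symm.trans hw)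
    refine ⟨_, S.mem_graph_opD τ u₁ u₂ v w', ?_⟩
    rwa [hf]

theorem A₂DomainEqHalf_of_isClosed (hclosed : (S.opD τ).IsClosed) : S.A₂DomainEqHalf := by
  rintro w ⟨f, hw⟩
  have hmem := S.mem_graph_closure_opD τ 0 0 0 hw
  rw [← (S.isClosable_opD τ).graph_closure_eq_closure_graph,
    hclosed.submodule_topologicalClosure_eq] at hmem
  obtain ⟨W, hW, -⟩ := (LinearPMap.mem_graph_iff _).1 hmem
  have hWw : Scaled.toBase τ H₁ W.1.snd.snd = w :=
    congrArg (fun Y => Scaled.toBase τ H₁ Y.snd.snd) hW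
  exact hWw ▸ W.2.2.2.2

end Delayed

end ThermoElastic

end

theorem theorem2p1 {H₁ H₂ : Type*} [NormedAddCommGroup H₁] [InnerProductSpace ℂ H₁]
    [CompleteSpace H₁] [NormedAddCommGroup H₂] [InnerProductSpace ℂ H₂] [CompleteSpace H₂]
    (S : ThermoElastic H₁ H₂) (τ : ℝ) (hτ : 0 < τ) :
    (GeneratesContractionSemigroup (S.opD ⟨τ, hτ⟩) ↔ S.A₂DomainEqHalf) ∧
    ((S.opD ⟨τ, hτ⟩).IsClosable ∧ GeneratesContractionSemigroup (S.opD ⟨τ, hτ⟩).closure) ∧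
    GeneratesContractionSemigroup S.op₀ := by
  refine ⟨⟨fun h => S.A₂DomainEqHalf_of_isClosed h.isClosed, fun h => ?_⟩,
    ⟨S.isClosable_opD _, ?_⟩, ?_⟩
  · exact (S.isMaxDissipative_opD h).generatesContractionSemigroup (S.dense_opD_domain _)
  · exact (S.isMaxDissipative_closure_opD _).generatesContractionSemigroup
      (S.dense_closure_opD_domain _)
  · exact S.isMaxDissipative_op₀.generatesContractionSemigroup S.dense_op₀_domain
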